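/- Let $d\in\{2,3\}$, let $\Omega\subset\mathbb{R}^d$ be a bounded domain of class $C^2$ with outward unit normal $\mathbf n$, let $T>0$, and let $\varepsilon_0,\mu_0,\mu_1,\dots,\mu_m>0$ be constants. Let $B_1,\dots,B_m\subset\mathbb{R}^d$ be bounded smooth domains containing the origin, and let $c_0>0$. For points $z=(z_1,\dots,z_m)\in\Omega^m$ with $$|z_j-z_l|\ge c_0\ (j\ne l),\qquad \operatorname{dist}(z_j,\partial\Omega)\ge c_0\ \text{ for all } j, \tag{1}$$ and for $\alpha>0$ small, so that the inhomogeneities $z_j+\alpha B_j$ are disjoint and contained in $\Omega$, let $\mu_\alpha=\mu_j$ on $z_j+\alpha B_j$ for $j=1,\dots,m$ and $\mu_\alpha=\mu_0$ elsewhere in $\Omega$. Let $\varphi,\psi\in C^\infty(\overline\Omega)^d$, let $f$ be boundary data on $\partial\Omega\times(0,T)$, and suppose that $E\in C^\infty([0,T]\times\overline\Omega)^d$ solves $$\Big(\varepsilon_0\partial_t^2+\operatorname{curl}\tfrac1{\mu_0}\operatorname{curl}\Big)E=0,\quad \operatorname{div}(\varepsilon_0E)=0\ \text{ in }\Omega\times(0,T),\qquad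 E|_{t=0}=\varphi,\ \ \partial_tE|_{t=0}=\psi,\qquad E\times\mathbf n=f\ \text{ on }\partial\Omega\times(0,T).$$ Then there are constants $\alpha_0>0$ and $C>0$, independent of $z$ and $\alpha$, such that for all $z$ satisfying (1), all $0<\alpha<\alpha_0$, and every weak solution $E_\alpha\in C^0([0,T];\mathbf H(\operatorname{curl};\Omega))\cap C^1([0,T];\mathbf L^2(\Omega))$ of $$\Big(\varepsilon_0\partial_t^2+\operatorname{curl}\tfrac1{\mu_\alpha}\operatorname{curl}\Big)E_\alpha=0,\quad \operatorname{div}(\varepsilon_0E_\alpha)=0\ \text{ in }\Omega\times(0,T),\qquad E_\alpha|_{t=0}=\varphi,\ \ \partial_tE_\alpha|_{t=0}=\psi,\qquad E_\alpha\times\mathbf n=f\ \text{ on }\partial\Omega\times(0,T),$$ one has $$\|\operatorname{curl}(E_\alpha-E)\|_{L^\infty(0,T;\mathbf L^2(\Omega))}\le C\alpha .$$ Here $\operatorname{curl}$ of $E_\alpha$ is the distributional curl and $E_\alpha\times\mathbf n=f$ means: for each $t\in(0,T)$, $f(t)$ is the pointwise tangential trace $G\times\mathbf n$ of some field $G\in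 C^1(\overline\Omega)^d$, and for each such $G$ the field $E_\alpha(t)-G$ belongs to the closure of $C_c^\infty(\Omega)^d$ in $\mathbf H(\operatorname{curl};\Omega)$. -/

import Mathlib

open MeasureTheory Set
open scoped ContDiff ENNReal

noncomputable section

/-! ### Vector calculus in dimension two and three

The exterior product `u × v` and the curl are written in the coordinates
`u i * v j - u j * v i` and `∂ i (u j) - ∂ j (u i)`, one for each pair `i < j`.
For `d = 2` this is the usual scalar; for `d = 3` these are the three coordinates of the usual
vector (listed as third, minus the second, first), so Euclidean norms and inner products are
the usual ones. -/

/-- Vectors of `ℝ^d` with the Euclidean norm. -/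
abbrev Vec (d : ℕ) : Type := EuclideanSpace ℝ (Fin d)

/-- Values of cross products and of curls: a scalar for `d = 2`, a vector for `d = 3`. -/
abbrev CurlVec (d : ℕ) : Type := EuclideanSpace ℝ {p : Fin d × Fin d // p.1 < p.2}

/-- The cross product of two vectors. -/
def cross {d : ℕ} (u v : Vec d) : CurlVec d :=
  WithLp.toLp 2 fun p => u p.1.1 * v p.1.2 - u p.1.2 * v p.1.1

/-- The classical partial derivative in the `i`-th coordinate direction. -/
def partialD {d : ℕ} {F : Type*} [NormedAddCommGroup F] [NormedSpace ℝ F]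
    (i : Fin d) (u : Vec d → F) (x : Vec d) : F :=
  fderiv ℝ u x (EuclideanSpace.single i 1)

/-- The classical curl of a vector field. -/
def curl {d : ℕ} (u : Vec d → Vec d) (x : Vec d) : CurlVec d :=
  WithLp.toLp 2 fun p =>
    partialD p.1.1 (fun y => u y p.1.2) x - partialD p.1.2 (fun y => u y p.1.1) x

/-- The classical curl of a field with values in `CurlVec d`: for `d = 2` this is
`(∂₂ s, -∂₁ s)`, for `d = 3` the usual curl. -/
def vcurl {d : ℕ} (s : Vec d → CurlVec d) (x : Vec d) : Vec d :=
  WithLp.toLp 2 fun k => ∑ p : {p : Fin d × Fin d // p.1 < p.2},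
    ((if p.1.1 = k then partialD p.1.2 (fun y => s y p) x else 0)
      - (if p.1.2 = k then partialD p.1.1 (fun y => s y p) x else 0))

/-- The classical divergence of a vector field. -/
def divergence {d : ℕ} (u : Vec d → Vec d) (x : Vec d) : ℝ :=
  ∑ i, partialD i (fun y => u y i) x

/-! ### Domains of class `C^k` -/

/-- `ρ` is of class `C^k` near `x`, has non-zero differential at `x`, and `Ω` coincides with
`{ρ < 0}` near `x`. -/
def IsLocalDefiningFunction {d : ℕ} (k : WithTop ℕ∞) (Ω : Set (Vec d)) (x : Vec d)
    (ρ : Vec d → ℝ) : Prop :=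
  ∃ U : Set (Vec d), IsOpen U ∧ x ∈ U ∧ ContDiffOn ℝ k ρ U ∧ fderiv ℝ ρ x ≠ 0 ∧
    ∀ y ∈ U, y ∈ Ω ↔ ρ y < 0

/-- Bounded domains (non-empty, open, connected) with boundary of class `C^k`. -/
structure IsBoundedDomain {d : ℕ} (k : WithTop ℕ∞) (Ω : Set (Vec d)) : Prop where
  isOpen : IsOpen Ω
  isConnected : IsConnected Ω
  isBounded : Bornology.IsBounded Ω
  boundary : ∀ x ∈ frontier Ω, ∃ ρ, IsLocalDefiningFunction k Ω x ρ

/-- `ν` is the outward unit normal to `Ω` at the boundary point `x`. -/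
def IsOutwardUnitNormal {d : ℕ} (Ω : Set (Vec d)) (x ν : Vec d) : Prop :=
  ∃ ρ, IsLocalDefiningFunction 1 Ω x ρ ∧ ν = ‖gradient ρ x‖⁻¹ • gradient ρ x

/-- `G × n = h` pointwise on `∂Ω`. -/
def CrossNormalEq {d : ℕ} (Ω : Set (Vec d)) (G : Vec d → Vec d) (h : Vec d → CurlVec d) :
    Prop :=
  ∀ x ∈ frontier Ω, ∀ ν, IsOutwardUnitNormal Ω x ν → cross (G x) ν = h x

/-! ### Weak derivatives and traces -/

/-- Smooth functions with compact support contained in `Ω`. -/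
structure IsTestFunction {d : ℕ} {F : Type*} [NormedAddCommGroup F] [NormedSpace ℝ F]
    (Ω : Set (Vec d)) (v : Vec d → F) : Prop where
  contDiff : ContDiff ℝ ∞ v
  hasCompactSupport : HasCompactSupport v
  tsupport_subset : tsupport v ⊆ Ω

/-- `g` is the curl of `u` in the sense of distributions on `Ω`. -/
def IsWeakCurl {d : ℕ} (Ω : Set (Vec d)) (u : Vec d → Vec d) (g : Vec d → CurlVec d) : Prop :=
  ∀ η : Vec d → ℝ, IsTestFunction Ω η → ∀ p : {p : Fin d × Fin d // p.1 < p.2},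
    ∫ x in Ω, g x p * η x
      = - ∫ x in Ω, (u x p.1.2 * partialD p.1.1 η x - u x p.1.1 * partialD p.1.2 η x)

/-- `div u = 0` in the sense of distributions on `Ω`. -/
def IsWeakDivFree {d : ℕ} (Ω : Set (Vec d)) (u : Vec d → Vec d) : Prop :=
  ∀ η : Vec d → ℝ, IsTestFunction Ω η → ∫ x in Ω, ∑ i, u x i * partialD i η x = 0

/-- `u`, with curl `g`, belongs to the closure of the smooth compactly supported fields in
`H(curl; Ω)`, that is, `u × n = 0` on `∂Ω` in the sense of `H(curl; Ω)`. -/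
def HasZeroTangentialTrace {d : ℕ} (Ω : Set (Vec d)) (u : Vec d → Vec d)
    (g : Vec d → CurlVec d) : Prop :=
  ∀ δ : ℝ, 0 < δ → ∃ v : Vec d → Vec d, IsTestFunction Ω v ∧
    eLpNorm (fun x => u x - v x) 2 (volume.restrict Ω) < ENNReal.ofReal δ ∧
    eLpNorm (fun x => g x - curl v x) 2 (volume.restrict Ω) < ENNReal.ofReal δ

/-- `u × n = h` on `∂Ω` for a field `u` with curl `g`: the datum `h` is the pointwise tangential
trace of fields that are `C^1` up to the boundary, and `u` differs from these by a
field with vanishing tangential trace (all such extensions of `h` differ by such fields). -/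
def HasTangentialTrace {d : ℕ} (Ω : Set (Vec d)) (u : Vec d → Vec d)
    (g : Vec d → CurlVec d) (h : Vec d → CurlVec d) : Prop :=
  (∃ G : Vec d → Vec d, ContDiffOn ℝ 1 G (closure Ω) ∧ CrossNormalEq Ω G h) ∧
  ∀ G : Vec d → Vec d, ContDiffOn ℝ 1 G (closure Ω) → CrossNormalEq Ω G h →
    HasZeroTangentialTrace Ω (fun x => u x - G x) (fun x => g x - curl G x)

/-! ### The Maxwell problems -/

/-- The inhomogeneity `z + α B`. -/
def inhomogeneity {d : ℕ} (z : Vec d) (α : ℝ) (B : Set (Vec d)) : Set (Vec d) :=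
  (fun y => z + α • y) '' B

/-- The permeability equal to `μ j` in the (disjoint) inhomogeneities `z j + α B j` and to `μ₀`
elsewhere. -/
def permeability {d m : ℕ} (μ₀ : ℝ) (μ : Fin m → ℝ) (z : Fin m → Vec d) (α : ℝ)
    (B : Fin m → Set (Vec d)) (x : Vec d) : ℝ :=
  μ₀ + ∑ j, (inhomogeneity (z j) α (B j)).indicator (fun _ => μ j - μ₀) x

/-- `E ∈ C^∞([0,T] × closure Ω)` is a classical solution of the Maxwell equations with constant
coefficients `ε₀`, `μ₀`, initial data `φ`, `ψ` and boundary data `E × n = f`. -/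
structure IsClassicalMaxwellSolution {d : ℕ} (Ω : Set (Vec d)) (T ε₀ μ₀ : ℝ)
    (φ ψ : Vec d → Vec d) (f : ℝ → Vec d → CurlVec d) (E : ℝ → Vec d → Vec d) : Prop where
  smooth : ContDiffOn ℝ ∞ (fun q : ℝ × Vec d => E q.1 q.2) (Icc 0 T ×ˢ closure Ω)
  equation : ∀ t ∈ Ioo 0 T, ∀ x ∈ Ω,
    ε₀ • iteratedDeriv 2 (fun s => E s x) t
      + vcurl (fun y => (1 / μ₀) • curl (E t) y) x = 0
  div_free : ∀ t ∈ Ioo 0 T, ∀ x ∈ Ω, divergence (fun y => ε₀ • E t y) x = 0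
  initial : ∀ x ∈ Ω, E 0 x = φ x
  initial_deriv : ∀ x ∈ Ω, derivWithin (fun s => E s x) (Icc 0 T) 0 = ψ x
  boundary : ∀ t ∈ Ioo 0 T, CrossNormalEq Ω (E t) (f t)

/-- `E` is a weak solution of the Maxwell equations with constant permittivity `ε₀` and variable
permeability `μ`, in the class `C^0([0,T]; H(curl; Ω)) ∩ C^1([0,T]; L²(Ω))`. Here `E'` is the
time derivative and `G` the curl of `E`. Since `G` is continuous in time, the weak form of
`ε₀ ∂ₜ² E + curl (1/μ) curl E = 0` says that `(ε₀ E'(t), v)` is differentiable in `t` for each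
test field `v`. -/
def IsWeakMaxwellSolution {d : ℕ} (Ω : Set (Vec d)) (T ε₀ : ℝ) (μ : Vec d → ℝ)
    (φ ψ : Vec d → Vec d) (f : ℝ → Vec d → CurlVec d)
    (E : ℝ → Lp (Vec d) 2 (volume.restrict Ω)) : Prop :=
  ∃ (E' : ℝ → Lp (Vec d) 2 (volume.restrict Ω))
    (G : ℝ → Lp (CurlVec d) 2 (volume.restrict Ω)),
    ContinuousOn E' (Icc 0 T) ∧
    (∀ t ∈ Icc 0 T, HasDerivWithinAt E (E' t) (Icc 0 T) t) ∧
    ContinuousOn G (Icc 0 T) ∧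
    (∀ t ∈ Icc 0 T, IsWeakCurl Ω (E t) (G t)) ∧
    (∀ v : Vec d → Vec d, IsTestFunction Ω v → ∀ t ∈ Ioo 0 T,
      HasDerivAt (fun s => ∫ x in Ω, ε₀ * inner ℝ (E' s x) (v x))
        (- ∫ x in Ω, 1 / μ x * inner ℝ (G t x) (curl v x)) t) ∧
    (∀ t ∈ Ioo 0 T, IsWeakDivFree Ω (fun x => ε₀ • E t x)) ∧
    (E 0 =ᵐ[volume.restrict Ω] φ) ∧
    (E' 0 =ᵐ[volume.restrict Ω] ψ) ∧
    (∀ t ∈ Ioo 0 T, HasTangentialTrace Ω (E t) (G t) (f t))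

end

/-!
The difference `w = E_α - E` solves the Maxwell system with permeability `μ_α`, zero initial data,
zero tangential trace and source `curl F`, where `F = (1/μ₀ - 1/μ_α) curl E`. The boundary condition
needs no trace theorem: the boundary values of `E_α` are prescribed relative to every `C¹` extension
of the datum, and `E(t)` is one. The field `F` is supported in the inhomogeneities, and `curl E` and
its time derivative are bounded, so `F` is bounded and Lipschitz in time with values in `L²`, with
constants of order `α ^ (d / 2) ≤ α` (`norm_smul_sub_lpMul_le`, `sqrt_volume_inhomogeneities_le`).

Testing formally with `w'` gives
`½ (ε₀ ‖w'‖² + (μ_α⁻¹ curl w, curl w)) = (F, curl w) - ∫ (F', curl w)`, whence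
`sup ‖curl w‖ ≤ C α` after division by `sup ‖curl w‖`. Since `w'` takes values in `L²` only, it is
not an admissible test field. The identity is proved for the Steklov averages of `w`, whose time
derivatives are difference quotients of `w` and hence admissible, and then passed to the limit.
This is carried out for pairs `(w, curl w)` in an abstract closed subspace of a product of two
Hilbert spaces, the closed span of the pairs `(v, curl v)` of test fields (`energy_inequality`,
`norm_le_of_weak_wave_equation`, `IsWeakMaxwellSolution.exists_curl_sub_norm_le`).

The field `E` is smooth on `[0, T] × closure Ω` in the sense of local Taylor expansions, and
compactness bounds all its derivatives on `[0, T] × Ω` (`SmoothBounded.of_isCompact`); thus its time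
slices are differentiable curves in `L²`, and integration by parts against test fields inside `Ω`
gives the weak form of its equation.
-/

open MeasureTheory Set
open scoped ContDiff ENNReal

noncomputable section

/-! ### An energy estimate for abstract wave equations -/

section DiffQuotient

variable {X : Type*} [NormedAddCommGroup X] [NormedSpace ℝ X]

/-- The forward difference quotient of step `h`. Applied to a primitive of `u` it is the Steklov
average of `u`. -/
def diffQuotient (h : ℝ) (u : ℝ → X) (t : ℝ) : X := h⁻¹ • (u (t + h) - u t)

theorem hasDerivAt_diffQuotient {u u' : ℝ → X} (hu : ∀ t, HasDerivAt u (u' t) t) (h t : ℝ) :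
    HasDerivAt (diffQuotient h u) (diffQuotient h u' t) t := by
  have h1 : HasDerivAt (fun s => u (s + h)) (u' (t + h)) t := (hu (t + h)).comp_add_const t h
  exact (h1.sub (hu t)).const_smul h⁻¹

theorem tendsto_diffQuotient {u : ℝ → X} {u' : X} {t : ℝ} (hu : HasDerivAt u u' t) :
    Filter.Tendsto (fun h => diffQuotient h u t) (nhdsWithin 0 (Ioi 0)) (nhds u') :=
  hu.tendsto_slope_zero.mono_left (nhdsWithin_mono _ fun _ hx => ne_of_gt hx)

theorem norm_diffQuotient_le {u u' : ℝ → X} {a b C : ℝ}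
    (hu : ∀ t, HasDerivAt u (u' t) t) (hC : ∀ t ∈ Icc a b, ‖u' t‖ ≤ C) {h t : ℝ} (hh : 0 < h)
    (ht : a ≤ t) (hth : t + h ≤ b) : ‖diffQuotient h u t‖ ≤ C := by
  have := norm_image_sub_le_of_norm_deriv_le_segment' (f := u) (f' := u') (a := t) (b := t + h)
    (C := C) (fun x _ => (hu x).hasDerivWithinAt)
    (fun x hx => hC x ⟨ht.trans hx.1, hx.2.le.trans hth⟩) (t + h) ⟨by linarith, le_rfl⟩
  rw [diffQuotient, norm_smul, norm_inv, Real.norm_of_nonneg hh.le, inv_mul_le_iff₀ hh]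
  linarith

end DiffQuotient

section Energy

variable {H K : Type*} [NormedAddCommGroup H] [InnerProductSpace ℝ H]
  [NormedAddCommGroup K] [InnerProductSpace ℝ K]

/-- The energy inequality for weak solutions of `ε w'' + c* A c w = c* F` with `g = c w`, where the
graph of `c` is a subspace `V` and the equation is integrated once in time (`P`, `Q` are
primitives of `g`, `F`). As `w'` need not lie in the domain of `c`, it is not an admissible test
field; its Steklov averages are, being difference quotients of `w`, and the energy identity is
derived for these and passed to the limit. -/
theorem energy_inequality {T ε M S : ℝ}
    (A : K →L[ℝ] K) (hAsymm : ∀ x y, inner ℝ (A x) y = inner ℝ x (A y))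
    (V : Submodule ℝ (H × K)) {w w' : ℝ → H} {P g Q F : ℝ → K}
    (hw : ∀ t, HasDerivAt w (w' t) t) (hP : ∀ t, HasDerivAt P (g t) t)
    (hQ : ∀ t, HasDerivAt Q (F t) t)
    (hFL : ∀ s t, ‖F s - F t‖ ≤ M * |s - t|)
    (hgS : ∀ t ∈ Icc 0 T, ‖g t‖ ≤ S)
    (hV : ∀ t ∈ Icc 0 T, (w t, g t) ∈ V)
    (heq : ∀ v ∈ V, ∀ s ∈ Icc 0 T, ∀ t ∈ Icc 0 T,
      ε * inner ℝ (w' t - w' s) v.1 = inner ℝ ((Q t - Q s) - A (P t - P s)) v.2)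
    (hw0 : w' 0 = 0) (hg0 : g 0 = 0) {t : ℝ} (ht : t ∈ Ico 0 T) :
    ε / 2 * inner ℝ (w' t) (w' t) + 1 / 2 * inner ℝ (A (g t)) (g t)
      ≤ inner ℝ (F t) (g t) + M * S * t := by
  have hM : 0 ≤ M := by simpa using (norm_nonneg _).trans (hFL 1 0)
  let Φ : ℝ → ℝ → ℝ := fun h s =>
    ε / 2 * inner ℝ (diffQuotient h w s) (diffQuotient h w s)
      + 1 / 2 * inner ℝ (A (diffQuotient h P s)) (diffQuotient h P s)
      - inner ℝ (diffQuotient h Q s) (diffQuotient h P s)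
  have hlim : ∀ s, Filter.Tendsto (fun h => Φ h s) (nhdsWithin 0 (Ioi 0))
      (nhds (ε / 2 * inner ℝ (w' s) (w' s) + 1 / 2 * inner ℝ (A (g s)) (g s)
        - inner ℝ (F s) (g s))) := fun s => by
    have h1 := tendsto_diffQuotient (hw s)
    have h2 := tendsto_diffQuotient (hP s)
    have h3 := tendsto_diffQuotient (hQ s)
    exact (((h1.inner h1).const_mul _).add
      ((((A.continuous.tendsto _).comp h2).inner h2).const_mul _)).sub (h3.inner h2)
  have hstep : ∀ h, 0 < h → t + h ≤ T → Φ h t ≤ Φ h 0 + M * S * t := by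
    intro h hh hth
    have hder : ∀ s ∈ Icc 0 t, HasDerivWithinAt (Φ h)
        (-inner ℝ (diffQuotient h F s) (diffQuotient h P s)) (Icc 0 t) s := by
      intro s hs
      have hsI : s ∈ Icc 0 T := ⟨hs.1, hs.2.trans ht.2.le⟩
      have hshI : s + h ∈ Icc 0 T := ⟨by linarith [hs.1], by linarith [hs.2]⟩
      have h1 := hasDerivAt_diffQuotient hw h s
      have h2 := hasDerivAt_diffQuotient hP h s
      have h3 := hasDerivAt_diffQuotient hQ h s
      have h2A := (A.hasFDerivAt.comp_hasDerivAt s h2)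
      -- the equation tested with the difference quotient of `w`
      have hmem : (diffQuotient h w s, diffQuotient h g s) ∈ V :=
        V.smul_mem h⁻¹ (V.sub_mem (hV _ hshI) (hV _ hsI))
      have htest : ε * inner ℝ (diffQuotient h w' s) (diffQuotient h w s)
          = inner ℝ (diffQuotient h Q s - A (diffQuotient h P s)) (diffQuotient h g s) := by
        have := heq _ hmem s hsI (s + h) hshI
        simp only at this
        have e1 : diffQuotient h Q s - A (diffQuotient h P s)
            = h⁻¹ • ((Q (s + h) - Q s) - A (P (s + h) - P s)) := by
          simp only [diffQuotient, ContinuousLinearMap.map_smul]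
          rw [← smul_sub]
        rw [e1, real_inner_smul_left, ← this]
        simp only [diffQuotient, real_inner_smul_left]
        ring
      have hall := (((h1.inner ℝ h1).const_mul (ε / 2)).add
        ((h2A.inner ℝ h2).const_mul (1 / 2))).sub (h3.inner ℝ h2)
      refine (hall.congr_deriv ?_).hasDerivWithinAt
      simp only [Function.comp_apply]
      rw [inner_sub_left] at htest
      rw [hAsymm (diffQuotient h g s),
        real_inner_comm (A (diffQuotient h P s)) (diffQuotient h g s),
        real_inner_comm (diffQuotient h w' s) (diffQuotient h w s)]
      linarith
    have hb : ∀ s ∈ Ico 0 t,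
        ‖-inner ℝ (diffQuotient h F s) (diffQuotient h P s)‖ ≤ M * S := by
      intro s hs
      rw [norm_neg]
      refine (norm_inner_le_norm _ _).trans (mul_le_mul ?_ ?_ (norm_nonneg _) hM)
      · rw [diffQuotient, norm_smul, norm_inv, Real.norm_of_nonneg hh.le, inv_mul_le_iff₀ hh]
        have := hFL (s + h) s
        rw [add_sub_cancel_left, abs_of_pos hh] at this
        linarith
      · exact norm_diffQuotient_le hP hgS hh hs.1 (by linarith [hs.2])
    have := norm_image_sub_le_of_norm_deriv_le_segment' hder hb t ⟨ht.1, le_rfl⟩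
    rw [sub_zero] at this
    linarith [(Real.le_norm_self _).trans this]
  have hfin := le_of_tendsto_of_tendsto (hlim t) ((hlim 0).add_const (M * S * t)) (by
    filter_upwards [Ioo_mem_nhdsGT (sub_pos.2 ht.2)] with h hh
    exact hstep h hh.1 (by linarith [hh.2]))
  simp only [hw0, hg0, inner_zero_right, map_zero] at hfin
  linarith

/-- The norm bound extracted from the energy inequality: the maximum of `‖g‖` is attained on the
compact time interval, and the inequality is quadratic in it. -/
theorem norm_le_of_wave_equation {T ε ν M : ℝ} (hT : 0 < T) (hε : 0 ≤ ε) (hν : 0 < ν)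
    (A : K →L[ℝ] K) (hAsymm : ∀ x y, inner ℝ (A x) y = inner ℝ x (A y))
    (hAν : ∀ x, ν * ‖x‖ ^ 2 ≤ inner ℝ (A x) x)
    (V : Submodule ℝ (H × K)) {w w' : ℝ → H} {P g Q F : ℝ → K}
    (hw : ∀ t, HasDerivAt w (w' t) t) (hP : ∀ t, HasDerivAt P (g t) t)
    (hQ : ∀ t, HasDerivAt Q (F t) t) (hgc : Continuous g)
    (hF : ∀ t, ‖F t‖ ≤ M) (hFL : ∀ s t, ‖F s - F t‖ ≤ M * |s - t|)
    (hV : ∀ t ∈ Icc 0 T, (w t, g t) ∈ V)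
    (heq : ∀ v ∈ V, ∀ s ∈ Icc 0 T, ∀ t ∈ Icc 0 T,
      ε * inner ℝ (w' t - w' s) v.1 = inner ℝ ((Q t - Q s) - A (P t - P s)) v.2)
    (hw0 : w' 0 = 0) (hg0 : g 0 = 0) {t : ℝ} (ht : t ∈ Icc 0 T) :
    ‖g t‖ ≤ 2 * (1 + T) / ν * M := by
  obtain ⟨r, hr, hrmax⟩ := isCompact_Icc.exists_isMaxOn (nonempty_Icc.2 hT.le)
    hgc.norm.continuousOn (s := Icc (0 : ℝ) T)
  have hM : 0 ≤ M := (norm_nonneg _).trans (hF 0)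
  have hmax : ∀ s ∈ Icc 0 T, ‖g s‖ ≤ ‖g r‖ := fun s hs => hrmax hs
  have key : ∀ s ∈ Ico 0 T, ν / 2 * ‖g s‖ ^ 2 ≤ M * (1 + T) * ‖g r‖ := by
    intro s hs
    have h1 := energy_inequality A hAsymm V hw hP hQ hFL hmax hV heq hw0 hg0 hs
    have h2 := hAν (g s)
    have h3 : 0 ≤ ε / 2 * inner ℝ (w' s) (w' s) :=
      mul_nonneg (by linarith) real_inner_self_nonneg
    have h4 : inner ℝ (F s) (g s) ≤ M * ‖g r‖ :=
      (real_inner_le_norm _ _).trans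
        (mul_le_mul (hF s) (hmax s ⟨hs.1, hs.2.le⟩) (norm_nonneg _) hM)
    have h5 : M * ‖g r‖ * s ≤ M * ‖g r‖ * T :=
      mul_le_mul_of_nonneg_left hs.2.le (mul_nonneg hM (norm_nonneg _))
    nlinarith
  have key' : ν / 2 * ‖g r‖ ^ 2 ≤ M * (1 + T) * ‖g r‖ := by
    have hcl : IsClosed {s : ℝ | ν / 2 * ‖g s‖ ^ 2 ≤ M * (1 + T) * ‖g r‖} :=
      isClosed_le ((hgc.norm.pow 2).const_mul _) continuous_const
    have := hcl.closure_subset_iff.2 (fun s hs => key s hs : Ico 0 T ⊆ _)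
    rw [closure_Ico hT.ne] at this
    exact this hr
  refine (hmax t ht).trans ?_
  rcases (norm_nonneg (g r)).eq_or_lt with h0 | h0
  · rw [← h0]; positivity
  · have : ν / 2 * ‖g r‖ ≤ M * (1 + T) := by
      refine le_of_mul_le_mul_right ?_ h0
      linarith [sq (‖g r‖)]
    rw [div_mul_eq_mul_div, le_div_iff₀ hν]
    linarith

/-- The energy estimate for weak solutions on `[0, T]`. The equation is only tested with the
elements of a set `D` of pairs `(v, c v)`, and `(w, c w)` lies in the closed span of `D`. -/
theorem norm_le_of_weak_wave_equation [CompleteSpace H] [CompleteSpace K]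
    {T ε ν M : ℝ} (hT : 0 < T) (hε : 0 ≤ ε) (hν : 0 < ν)
    (A : K →L[ℝ] K) (hAsymm : ∀ x y, inner ℝ (A x) y = inner ℝ x (A y))
    (hAν : ∀ x, ν * ‖x‖ ^ 2 ≤ inner ℝ (A x) x)
    (D : Set (H × K)) {w w' : ℝ → H} {g F : ℝ → K}
    (hw : ∀ t ∈ Icc 0 T, HasDerivWithinAt w (w' t) (Icc 0 T) t)
    (hw'c : ContinuousOn w' (Icc 0 T)) (hgc : ContinuousOn g (Icc 0 T))
    (hF : ∀ t ∈ Icc 0 T, ‖F t‖ ≤ M)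
    (hFL : ∀ s ∈ Icc 0 T, ∀ t ∈ Icc 0 T, ‖F s - F t‖ ≤ M * |s - t|)
    (hD : ∀ t ∈ Ioo 0 T, (w t, g t) ∈ (Submodule.span ℝ D).topologicalClosure)
    (heq : ∀ v ∈ D, ∀ t ∈ Ioo 0 T,
      HasDerivAt (fun s => ε * inner ℝ (w' s) v.1) (inner ℝ (F t - A (g t)) v.2) t)
    (hw0 : w' 0 = 0) (hg0 : g 0 = 0) {t : ℝ} (ht : t ∈ Icc 0 T) :
    ‖g t‖ ≤ 2 * (1 + T) / ν * M := by
  have h0 : (0 : ℝ) ∈ Icc 0 T := ⟨le_rfl, hT.le⟩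
  have hM : 0 ≤ M := (norm_nonneg _).trans (hF 0 h0)
  have hwc : ContinuousOn w (Icc 0 T) := fun s hs => (hw s hs).continuousWithinAt
  have hFc : ContinuousOn F (Icc 0 T) := by
    refine (LipschitzOnWith.of_dist_le_mul (K := ⟨M, hM⟩) fun s hs t ht => ?_).continuousOn
    rw [dist_eq_norm, Real.dist_eq]
    exact hFL s hs t ht
  -- all functions of time are extended by constants beyond the endpoints of `[0, T]`
  let p : ℝ → ℝ := fun s => projIcc 0 T hT.le s
  have hp : Continuous p := continuous_subtype_val.comp continuous_projIcc
  have hpmem : ∀ s, p s ∈ Icc 0 T := fun s => (projIcc 0 T hT.le s).2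
  have hpeq : ∀ s ∈ Icc 0 T, p s = s := fun s hs => by simp [p, projIcc_of_mem hT.le hs]
  have hpL : ∀ s t, |p s - p t| ≤ |s - t| := fun s t => by
    have := (LipschitzWith.projIcc hT.le).dist_le_mul s t
    simpa [Subtype.dist_eq, Real.dist_eq] using this
  have cw' : Continuous fun s => w' (p s) := hw'c.comp_continuous hp hpmem
  have cg : Continuous fun s => g (p s) := hgc.comp_continuous hp hpmem
  have cF : Continuous fun s => F (p s) := hFc.comp_continuous hp hpmem
  have hwint : ∀ s ∈ Icc 0 T, w 0 + ∫ τ in (0 : ℝ)..s, w' (p τ) = w s := by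
    intro s hs
    rw [intervalIntegral.integral_eq_sub_of_hasDeriv_right_of_le hs.1 (f := w)
      (hwc.mono (Icc_subset_Icc_right hs.2)) (fun r hr => ?_) (cw'.intervalIntegrable _ _)]
    · abel
    · have hrI : r ∈ Icc 0 T := ⟨hr.1.le, hr.2.le.trans hs.2⟩
      rw [hpeq r hrI]
      exact ((hw r hrI).hasDerivAt
        (Icc_mem_nhds hr.1 (hr.2.trans_le hs.2))).hasDerivWithinAt
  have hDI : ∀ s ∈ Icc 0 T, (w s, g s) ∈ (Submodule.span ℝ D).topologicalClosure := by
    intro s hs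
    have hmap : MapsTo (fun s => (w s, g s)) (Ioo 0 T)
      ((Submodule.span ℝ D).topologicalClosure : Set (H × K)) := hD
    have := hmap.closure_of_continuousOn (by
      rw [closure_Ioo hT.ne]; exact hwc.prodMk hgc)
    rw [closure_Ioo hT.ne] at this
    have h2 := this hs
    rwa [(Submodule.isClosed_topologicalClosure _).closure_eq] at h2
  have hint : ∀ v ∈ (Submodule.span ℝ D).topologicalClosure, ∀ s ∈ Icc 0 T, ∀ r ∈ Icc 0 T,
      ε * inner ℝ (w' (p r) - w' (p s)) v.1
        = inner ℝ (((∫ τ in (0 : ℝ)..r, F (p τ)) - ∫ τ in (0 : ℝ)..s, F (p τ))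
          - A ((∫ τ in (0 : ℝ)..r, g (p τ)) - ∫ τ in (0 : ℝ)..s, g (p τ))) v.2 := by
    intro v hv s hs r hr
    -- both sides are continuous linear in `v`
    let ℓ : H × K →L[ℝ] ℝ :=
      (ε • innerSL ℝ (w' (p r) - w' (p s))).comp (ContinuousLinearMap.fst ℝ H K)
        - (innerSL ℝ (((∫ τ in (0 : ℝ)..r, F (p τ)) - ∫ τ in (0 : ℝ)..s, F (p τ))
          - A ((∫ τ in (0 : ℝ)..r, g (p τ)) - ∫ τ in (0 : ℝ)..s, g (p τ)))).comp
            (ContinuousLinearMap.snd ℝ H K)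
    suffices h : (Submodule.span ℝ D).topologicalClosure ≤ ℓ.ker by
      have := h hv
      rw [LinearMap.mem_ker] at this
      exact sub_eq_zero.1 this
    refine Submodule.topologicalClosure_minimal _ (Submodule.span_le.2 fun v hv => ?_)
      ℓ.isClosed_ker
    rw [SetLike.mem_coe, LinearMap.mem_ker]
    -- from time `0` to time `r`
    have hone : ∀ r ∈ Icc 0 T, ε * inner ℝ (w' (p r)) v.1 - ε * inner ℝ (w' 0) v.1
        = inner ℝ ((∫ τ in (0 : ℝ)..r, F (p τ)) - A (∫ τ in (0 : ℝ)..r, g (p τ))) v.2 := by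
      intro r hr
      have e1 := intervalIntegral.integral_eq_sub_of_hasDerivAt_of_le hr.1
        (f := fun s => ε * inner ℝ (w' s) v.1)
        (f' := fun s => inner ℝ (F (p s) - A (g (p s))) v.2)
        (continuousOn_const.mul
          ((hw'c.mono (Icc_subset_Icc_right hr.2)).inner continuousOn_const))
        (fun s hs => by
          have := heq v hv s ⟨hs.1, hs.2.trans_le hr.2⟩
          rwa [hpeq s ⟨hs.1.le, hs.2.le.trans hr.2⟩])
        ((Continuous.inner (cF.sub (A.continuous.comp cg))
          continuous_const).intervalIntegrable _ _)
      rw [hpeq r hr, ← e1, ← A.intervalIntegral_comp_comm (cg.intervalIntegrable _ _),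
        ← intervalIntegral.integral_sub (f := fun τ => F (p τ)) (g := fun τ => A (g (p τ)))
          (cF.intervalIntegrable _ _)
          ((A.continuous.comp cg :).intervalIntegrable _ _),
        real_inner_comm]
      have := (innerSL ℝ v.2).intervalIntegral_comp_comm
        ((cF.sub (A.continuous.comp cg)).intervalIntegrable (μ := volume) 0 r)
      refine Eq.trans ?_ this
      exact intervalIntegral.integral_congr fun s _ => real_inner_comm _ _
    have e1 := hone r hr
    have e2 := hone s hs
    simp only [inner_sub_left] at e1 e2
    change ε * inner ℝ (w' (p r) - w' (p s)) v.1
      - inner ℝ (((∫ τ in (0 : ℝ)..r, F (p τ)) - ∫ τ in (0 : ℝ)..s, F (p τ))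
        - A ((∫ τ in (0 : ℝ)..r, g (p τ)) - ∫ τ in (0 : ℝ)..s, g (p τ))) v.2 = 0
    simp only [inner_sub_left, map_sub]
    linarith
  have := norm_le_of_wave_equation (w := fun s => w 0 + ∫ τ in (0 : ℝ)..s, w' (p τ))
    (w' := fun s => w' (p s)) (P := fun s => ∫ τ in (0 : ℝ)..s, g (p τ)) (g := fun s => g (p s))
    (Q := fun s => ∫ τ in (0 : ℝ)..s, F (p τ)) (F := fun s => F (p s))
    hT hε hν A hAsymm hAν (Submodule.span ℝ D).topologicalClosure
    (fun s => (cw'.integral_hasStrictDerivAt 0 s).hasDerivAt.const_add _)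
    (fun s => (cg.integral_hasStrictDerivAt 0 s).hasDerivAt)
    (fun s => (cF.integral_hasStrictDerivAt 0 s).hasDerivAt) cg (fun s => hF _ (hpmem s))
    (fun s t => (hFL _ (hpmem s) _ (hpmem t)).trans (mul_le_mul_of_nonneg_left (hpL s t) hM))
    (fun s hs => by rw [hwint s hs, hpeq s hs]; exact hDI s hs) hint
    (by rw [hpeq 0 h0]; exact hw0) (by rw [hpeq 0 h0]; exact hg0) ht
  rwa [hpeq t ht] at this

end Energy

/-! ### Integration by parts against test functions -/

section IntegrationByParts

variable {d : ℕ} {Ω : Set (Vec d)}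

theorem IsTestFunction.clm_comp {F G : Type*} [NormedAddCommGroup F] [NormedSpace ℝ F]
    [NormedAddCommGroup G] [NormedSpace ℝ G] {v : Vec d → F} (hv : IsTestFunction Ω v)
    (L : F →L[ℝ] G) : IsTestFunction Ω fun x => L (v x) where
  contDiff := L.contDiff.comp hv.contDiff
  hasCompactSupport := hv.hasCompactSupport.comp_left (map_zero L)
  tsupport_subset := (tsupport_comp_subset (map_zero L) v).trans hv.tsupport_subset

theorem IsTestFunction.apply {ι : Type*} [Fintype ι] {v : Vec d → EuclideanSpace ℝ ι}
    (hv : IsTestFunction Ω v) (i : ι) : IsTestFunction Ω fun x => v x i :=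
  hv.clm_comp (EuclideanSpace.proj i : EuclideanSpace ℝ ι →L[ℝ] ℝ)

theorem IsTestFunction.fderiv {F : Type*} [NormedAddCommGroup F] [NormedSpace ℝ F]
    {η : Vec d → F} (hη : IsTestFunction Ω η) : IsTestFunction Ω (fderiv ℝ η) where
  contDiff := hη.contDiff.fderiv_right (m := ∞) (by simp)
  hasCompactSupport := hη.hasCompactSupport.fderiv (𝕜 := ℝ)
  tsupport_subset := (tsupport_fderiv_subset ℝ).trans hη.tsupport_subset

theorem IsTestFunction.partialD {F : Type*} [NormedAddCommGroup F] [NormedSpace ℝ F]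
    {η : Vec d → F} (hη : IsTestFunction Ω η) (i : Fin d) : IsTestFunction Ω (partialD i η) :=
  hη.fderiv.clm_comp (ContinuousLinearMap.apply ℝ F (EuclideanSpace.single i (1 : ℝ)))

theorem IsTestFunction.memLp {F : Type*} [NormedAddCommGroup F] [NormedSpace ℝ F]
    {η : Vec d → F} (hη : IsTestFunction Ω η) (p : ℝ≥0∞) : MemLp η p (volume.restrict Ω) :=
  (hη.contDiff.continuous.memLp_of_hasCompactSupport hη.hasCompactSupport).restrict Ω

theorem IsTestFunction.eq_zero {F : Type*} [NormedAddCommGroup F] [NormedSpace ℝ F]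
    {η : Vec d → F} (hη : IsTestFunction Ω η) {x : Vec d} (hx : x ∉ Ω) : η x = 0 :=
  image_eq_zero_of_notMem_tsupport fun h => hx (hη.tsupport_subset h)

theorem ContinuousOn.integrable_mul_testFunction (hΩ : IsOpen Ω) {s : Vec d → ℝ}
    (hs : ContinuousOn s Ω) {η : Vec d → ℝ} (hη : IsTestFunction Ω η) :
    Integrable fun x => s x * η x := by
  refine Continuous.integrable_of_hasCompactSupport ?_ hη.hasCompactSupport.mul_left
  refine continuous_of_tsupport fun x hx => ?_
  have hxΩ : x ∈ Ω := hη.tsupport_subset (closure_mono (Function.support_mul_subset_right _ _) hx)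
  exact (hs.continuousAt (hΩ.mem_nhds hxΩ)).mul hη.contDiff.continuous.continuousAt

theorem ContDiffOn.continuousOn_partialD (hΩ : IsOpen Ω) {s : Vec d → ℝ}
    (hs : ContDiffOn ℝ 1 s Ω) (i : Fin d) : ContinuousOn (partialD i s) Ω :=
  (hs.continuousOn_fderiv_of_isOpen hΩ le_rfl).clm_apply continuousOn_const

theorem ContDiffOn.apply_euclidean {ι : Type*} [Fintype ι] {n : WithTop ℕ∞}
    {v : Vec d → EuclideanSpace ℝ ι} (hv : ContDiffOn ℝ n v Ω) (i : ι) :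
    ContDiffOn ℝ n (fun x => v x i) Ω :=
  (EuclideanSpace.proj i : EuclideanSpace ℝ ι →L[ℝ] ℝ).contDiff.comp_contDiffOn hv

theorem integral_mul_partialD (hΩ : IsOpen Ω) {s : Vec d → ℝ} (hs : ContDiffOn ℝ 1 s Ω)
    {η : Vec d → ℝ} (hη : IsTestFunction Ω η) (i : Fin d) :
    ∫ x in Ω, s x * partialD i η x = -∫ x in Ω, partialD i s x * η x := by
  rw [setIntegral_eq_integral_of_forall_compl_eq_zero
      (fun x hx => by rw [(hη.partialD i).eq_zero hx, mul_zero]),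
    setIntegral_eq_integral_of_forall_compl_eq_zero
      (fun x hx => by rw [hη.eq_zero hx, mul_zero])]
  exact integral_mul_fderiv_eq_neg_fderiv_mul_of_integrable
    ((hs.continuousOn_partialD hΩ i).integrable_mul_testFunction hΩ hη)
    (hs.continuousOn.integrable_mul_testFunction hΩ (hη.partialD i))
    (hs.continuousOn.integrable_mul_testFunction hΩ hη)
    (fun x hx => (hs.contDiffAt (hΩ.mem_nhds (hη.tsupport_subset hx))).differentiableAt
      one_ne_zero)
    (fun x _ => hη.contDiff.differentiable (by simp) x)

/-- The curl as a linear function of the differential. -/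
def curlCLM (d : ℕ) : (Vec d →L[ℝ] Vec d) →L[ℝ] CurlVec d :=
  ((EuclideanSpace.equiv {p : Fin d × Fin d // p.1 < p.2} ℝ).symm :
      ({p : Fin d × Fin d // p.1 < p.2} → ℝ) →L[ℝ] CurlVec d).comp
    (ContinuousLinearMap.pi fun p =>
      (EuclideanSpace.proj p.1.2 : Vec d →L[ℝ] ℝ).comp
          (ContinuousLinearMap.apply ℝ (Vec d) (EuclideanSpace.single p.1.1 (1 : ℝ)))
        - (EuclideanSpace.proj p.1.1 : Vec d →L[ℝ] ℝ).comp
          (ContinuousLinearMap.apply ℝ (Vec d) (EuclideanSpace.single p.1.2 (1 : ℝ))))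

theorem HasFDerivAt.curl_eq {u : Vec d → Vec d} {L : Vec d →L[ℝ] Vec d} {x : Vec d}
    (hu : HasFDerivAt u L x) : curl u x = curlCLM d L := by
  have h : ∀ i j, partialD i (fun y => u y j) x = L (EuclideanSpace.single i 1) j := fun i j => by
    have := ((EuclideanSpace.proj j : Vec d →L[ℝ] ℝ).hasFDerivAt.comp x hu).fderiv
    exact congrArg (fun D => D (EuclideanSpace.single i (1 : ℝ))) this
  ext p
  simp only [curl, h]
  rfl

theorem IsTestFunction.curl {v : Vec d → Vec d} (hv : IsTestFunction Ω v) :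
    IsTestFunction Ω (curl v) := by
  have : _root_.curl v = fun x => curlCLM d (_root_.fderiv ℝ v x) := funext fun x =>
    (hv.contDiff.differentiable (by simp) x).hasFDerivAt.curl_eq
  rw [this]
  exact hv.fderiv.clm_comp (curlCLM d)

theorem isWeakCurl_curl (hΩ : IsOpen Ω) {u : Vec d → Vec d} (hu : ContDiffOn ℝ 1 u Ω) :
    IsWeakCurl Ω u (curl u) := by
  intro η hη p
  have h1 := integral_mul_partialD hΩ (hu.apply_euclidean p.1.2) hη p.1.1
  have h2 := integral_mul_partialD hΩ (hu.apply_euclidean p.1.1) hη p.1.2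
  have i1 := ((hu.apply_euclidean p.1.2).continuousOn_partialD hΩ
    p.1.1).integrable_mul_testFunction hΩ hη
  have i2 := ((hu.apply_euclidean p.1.1).continuousOn_partialD hΩ
    p.1.2).integrable_mul_testFunction hΩ hη
  have i3 := (hu.apply_euclidean p.1.2).continuousOn.integrable_mul_testFunction hΩ
    (hη.partialD p.1.1)
  have i4 := (hu.apply_euclidean p.1.1).continuousOn.integrable_mul_testFunction hΩ
    (hη.partialD p.1.2)
  simp only [curl, sub_mul]
  rw [integral_sub i1.integrableOn i2.integrableOn, integral_sub i3.integrableOn i4.integrableOn]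
  linarith

theorem IsTestFunction.integrable_mul {f : Vec d → ℝ} (hf : MemLp f 2 (volume.restrict Ω))
    {η : Vec d → ℝ} (hη : IsTestFunction Ω η) :
    Integrable (fun x => f x * η x) (volume.restrict Ω) :=
  hf.integrable_mul (hη.memLp 2)

theorem IsWeakCurl.congr_ae {u u' : Vec d → Vec d} {g g' : Vec d → CurlVec d}
    (h : IsWeakCurl Ω u g) (hu : u =ᵐ[volume.restrict Ω] u') (hg : g =ᵐ[volume.restrict Ω] g') :
    IsWeakCurl Ω u' g' := by
  intro η hη p
  have e1 : ∫ x in Ω, g' x p * η x = ∫ x in Ω, g x p * η x := by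
    refine integral_congr_ae ?_
    filter_upwards [hg] with x hx
    rw [hx]
  rw [e1, h η hη p]
  congr 1
  refine integral_congr_ae ?_
  filter_upwards [hu] with x hx
  rw [hx]

theorem memLp_apply {ι : Type*} [Fintype ι] {u : Vec d → EuclideanSpace ℝ ι} {μ : Measure (Vec d)}
    (hu : MemLp u 2 μ) (i : ι) : MemLp (fun x => u x i) 2 μ :=
  (EuclideanSpace.proj i : EuclideanSpace ℝ ι →L[ℝ] ℝ).comp_memLp' hu

theorem IsWeakCurl.sub {u u' : Vec d → Vec d} {g g' : Vec d → CurlVec d}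
    (h : IsWeakCurl Ω u g) (h' : IsWeakCurl Ω u' g')
    (hu : MemLp u 2 (volume.restrict Ω)) (hu' : MemLp u' 2 (volume.restrict Ω))
    (hg : MemLp g 2 (volume.restrict Ω)) (hg' : MemLp g' 2 (volume.restrict Ω)) :
    IsWeakCurl Ω (fun x => u x - u' x) (fun x => g x - g' x) := by
  intro η hη p
  have e := h η hη p
  have e' := h' η hη p
  have iu : ∀ i j, Integrable (fun x => u x i * partialD j η x) (volume.restrict Ω) := fun i j =>
    (hη.partialD j).integrable_mul (memLp_apply hu i)
  have iu' : ∀ i j, Integrable (fun x => u' x i * partialD j η x) (volume.restrict Ω) := fun i j =>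
    (hη.partialD j).integrable_mul (memLp_apply hu' i)
  have e1 : ∫ x in Ω, (g x - g' x) p * η x
      = (∫ x in Ω, g x p * η x) - ∫ x in Ω, g' x p * η x := by
    rw [← integral_sub (hη.integrable_mul (memLp_apply hg p))
      (hη.integrable_mul (memLp_apply hg' p))]
    exact integral_congr_ae (Filter.Eventually.of_forall fun x => sub_mul _ _ _)
  rw [e1, e, e', ← neg_sub', ← integral_sub (by exact (iu _ _).sub (iu _ _))
    (by exact (iu' _ _).sub (iu' _ _))]
  congr 1
  refine integral_congr_ae (Filter.Eventually.of_forall fun x => ?_)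
  simp only [PiLp.sub_apply]
  ring

/-- The only square-integrable weak curl of zero is zero. -/
theorem IsWeakCurl.ae_eq_zero (hΩ : IsOpen Ω) {u : Vec d → Vec d} {g : Vec d → CurlVec d}
    (h : IsWeakCurl Ω u g) (hu : u =ᵐ[volume.restrict Ω] 0) (hg : MemLp g 2 (volume.restrict Ω)) :
    g =ᵐ[volume.restrict Ω] 0 := by
  have hp : ∀ p, ∀ᵐ x ∂volume.restrict Ω, g x p = 0 := by
    intro p
    rw [ae_restrict_iff' hΩ.measurableSet]
    refine hΩ.ae_eq_zero_of_integral_contDiff_smul_eq_zero ?_ ?_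
    · refine locallyIntegrableOn_of_locallyIntegrable_restrict ?_
      exact (memLp_apply hg p).locallyIntegrable one_le_two
    · intro η h1 h2 h3
      have hη : IsTestFunction Ω η := ⟨h1, h2, h3⟩
      have e := h η hη p
      have e0 : ∫ x in Ω, (u x p.1.2 * _root_.partialD p.1.1 η x
          - u x p.1.1 * _root_.partialD p.1.2 η x) = 0 := by
        refine (integral_congr_ae ?_).trans (integral_zero _ _)
        filter_upwards [hu] with x hx
        simp [hx]
      rw [e0, neg_zero] at e
      rw [← setIntegral_eq_integral_of_forall_compl_eq_zero (s := Ω)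
        (fun x hx => by rw [hη.eq_zero hx, zero_smul]), ← e]
      exact integral_congr_ae (Filter.Eventually.of_forall fun x => mul_comm _ _)
  filter_upwards [ae_all_iff.2 hp] with x hx
  ext p
  exact hx p

theorem inner_vcurl (s : Vec d → CurlVec d) (x v : Vec d) :
    inner ℝ (vcurl s x) v = ∑ p : {p : Fin d × Fin d // p.1 < p.2},
      (partialD p.1.2 (fun y => s y p) x * v p.1.1
        - partialD p.1.1 (fun y => s y p) x * v p.1.2) := by
  simp only [vcurl, PiLp.inner_apply, RCLike.inner_apply, conj_trivial, Finset.mul_sum]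
  rw [Finset.sum_comm]
  refine Finset.sum_congr rfl fun p _ => ?_
  simp [mul_sub, Finset.sum_sub_distrib, mul_comm]

/-- The operators `vcurl` and `curl` are formal adjoints of each other. -/
theorem integral_inner_vcurl (hΩ : IsOpen Ω) {s : Vec d → CurlVec d} (hs : ContDiffOn ℝ 1 s Ω)
    {v : Vec d → Vec d} (hv : IsTestFunction Ω v) :
    ∫ x in Ω, inner ℝ (vcurl s x) (v x) = ∫ x in Ω, inner ℝ (s x) (curl v x) := by
  have i1 : ∀ (p : {p : Fin d × Fin d // p.1 < p.2}) (i j : Fin d), Integrable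
      (fun x => partialD i (fun y => s y p) x * v x j) (volume.restrict Ω) := fun p i j =>
    (((hs.apply_euclidean p).continuousOn_partialD hΩ i).integrable_mul_testFunction hΩ
      (hv.apply j)).integrableOn
  have i2 : ∀ (p : {p : Fin d × Fin d // p.1 < p.2}) (i j : Fin d), Integrable
      (fun x => s x p * partialD i (fun y => v y j) x) (volume.restrict Ω) := fun p i j =>
    ((hs.apply_euclidean p).continuousOn.integrable_mul_testFunction hΩ
      ((hv.apply j).partialD i)).integrableOn
  have e : ∀ x, inner ℝ (s x) (curl v x) = ∑ p : {p : Fin d × Fin d // p.1 < p.2},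
      (s x p * partialD p.1.1 (fun y => v y p.1.2) x
        - s x p * partialD p.1.2 (fun y => v y p.1.1) x) := fun x => by
    simp only [curl, PiLp.inner_apply, RCLike.inner_apply, conj_trivial]
    exact Finset.sum_congr rfl fun p _ => by ring
  simp only [inner_vcurl, e]
  rw [integral_finsetSum _ fun p _ => by exact (i1 p _ _).sub (i1 p _ _),
    integral_finsetSum _ fun p _ => by exact (i2 p _ _).sub (i2 p _ _)]
  refine Finset.sum_congr rfl fun p _ => ?_
  rw [integral_sub (i1 p _ _) (i1 p _ _), integral_sub (i2 p _ _) (i2 p _ _),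
    integral_mul_partialD hΩ (hs.apply_euclidean p) (hv.apply _),
    integral_mul_partialD hΩ (hs.apply_euclidean p) (hv.apply _)]
  ring

end IntegrationByParts

/-! ### Smooth functions with bounded derivatives -/

section SmoothBounded

variable {X F G : Type*} [NormedAddCommGroup X] [NormedSpace ℝ X]
  [NormedAddCommGroup F] [NormedSpace ℝ F] [NormedAddCommGroup G] [NormedSpace ℝ G]

/-- `f` is smooth on `S` and all its derivatives (within `S`) are bounded on `S`. -/
structure SmoothBounded (S : Set X) (f : X → F) : Prop where
  contDiffOn : ContDiffOn ℝ ∞ f S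
  bounded : ∀ n : ℕ, ∃ M : ℝ, ∀ q ∈ S, ‖iteratedFDerivWithin ℝ n f S q‖ ≤ M

/-- Smoothness on a compact set bounds the derivatives on every subset with unique
differentiability. The compact set itself may fail to have unique derivatives, so its Taylor
series are only compared with the derivatives at points of the subset. -/
theorem SmoothBounded.of_isCompact {Q S : Set X} (hQ : IsCompact Q) (hSQ : S ⊆ Q)
    (hS : UniqueDiffOn ℝ S) {f : X → F} (hf : ContDiffOn ℝ ∞ f Q) : SmoothBounded S f where
  contDiffOn := hf.mono hSQ
  bounded n := by
    suffices h : ∃ M : ℝ, ∀ q ∈ Q, q ∈ S → ‖iteratedFDerivWithin ℝ n f S q‖ ≤ M by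
      obtain ⟨M, hM⟩ := h
      exact ⟨M, fun q hq => hM q (hSQ hq) hq⟩
    refine hQ.induction_on (p := fun R => ∃ M : ℝ, ∀ q ∈ R, q ∈ S →
      ‖iteratedFDerivWithin ℝ n f S q‖ ≤ M) ⟨0, by simp⟩ ?_ ?_ ?_
    · rintro R R' hRR' ⟨M, hM⟩
      exact ⟨M, fun q hq => hM q (hRR' hq)⟩
    · rintro R R' ⟨M, hM⟩ ⟨M', hM'⟩
      refine ⟨max M M', fun q hq hqS => ?_⟩
      rcases hq with hq | hq
      · exact (hM q hq hqS).trans (le_max_left _ _)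
      · exact (hM' q hq hqS).trans (le_max_right _ _)
    · intro q hq
      obtain ⟨u, hu, p, hp⟩ := (hf q hq).of_le (m := (n : WithTop ℕ∞))
        (by exact_mod_cast le_top) n le_rfl
      rw [insert_eq_of_mem hq] at hu
      have hc : ContinuousWithinAt (p · n) u q :=
        hp.cont n le_rfl q (mem_of_mem_nhdsWithin hq hu)
      have hb : ∀ᶠ y in nhdsWithin q u, ‖p y n‖ < ‖p q n‖ + 1 :=
        hc.norm.eventually (gt_mem_nhds (lt_add_one _))
      obtain ⟨O, hO, hqO, hOu⟩ := mem_nhdsWithin.1 hu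
      have hb' : ∀ᶠ y in nhdsWithin q Q, ‖p y n‖ < ‖p q n‖ + 1 := by
        refine Filter.Eventually.filter_mono ?_ hb
        rw [nhdsWithin_le_iff]
        exact hu
      refine ⟨{y | ‖p y n‖ < ‖p q n‖ + 1} ∩ (O ∩ Q),
        Filter.inter_mem hb' (mem_nhdsWithin.2 ⟨O, hO, hqO, subset_rfl⟩),
        ‖p q n‖ + 1, fun y hy hyS => ?_⟩
      have hp' : HasFTaylorSeriesUpToOn n f p (S ∩ O) :=
        hp.mono fun z hz => hOu ⟨hz.2, hSQ hz.1⟩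
      rw [← iteratedFDerivWithin_inter_open hO hy.2.1,
        ← hp'.eq_iteratedFDerivWithin_of_uniqueDiffOn le_rfl (hS.inter hO) ⟨hyS, hy.2.1⟩]
      exact hy.1.le

theorem SmoothBounded.smoothBounded_fderivWithin {S : Set X} {f : X → F} (hf : SmoothBounded S f)
    (hS : UniqueDiffOn ℝ S) : SmoothBounded S (fderivWithin ℝ f S) where
  contDiffOn := hf.contDiffOn.fderivWithin hS (by simp)
  bounded n := by
    obtain ⟨M, hM⟩ := hf.bounded (n + 1)
    exact ⟨M, fun q hq => by rw [norm_iteratedFDerivWithin_fderivWithin hS hq]; exact hM q hq⟩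

theorem SmoothBounded.clm_comp {S : Set X} {f : X → F} (hf : SmoothBounded S f)
    (hS : UniqueDiffOn ℝ S) (L : F →L[ℝ] G) : SmoothBounded S fun q => L (f q) where
  contDiffOn := L.contDiff.comp_contDiffOn hf.contDiffOn
  bounded n := by
    obtain ⟨M, hM⟩ := hf.bounded n
    refine ⟨‖L‖ * M, fun q hq => ?_⟩
    refine (L.norm_iteratedFDerivWithin_comp_left (hf.contDiffOn q hq) hS hq
      (n := n) (by exact_mod_cast le_top)).trans ?_
    exact mul_le_mul_of_nonneg_left (hM q hq) (norm_nonneg _)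

theorem SmoothBounded.exists_norm_le {S : Set X} {f : X → F} (hf : SmoothBounded S f) :
    ∃ M : ℝ, 0 ≤ M ∧ ∀ q ∈ S, ‖f q‖ ≤ M := by
  obtain ⟨M, hM⟩ := hf.bounded 0
  exact ⟨max M 0, le_max_right _ _, fun q hq =>
    le_max_of_le_left (by simpa using hM q hq)⟩

end SmoothBounded

/-! ### Time slices of smooth functions in `L²` -/

section TimeSlices

variable {d : ℕ} {F : Type*} [NormedAddCommGroup F] [NormedSpace ℝ F] {Ω : Set (Vec d)} {T : ℝ}

theorem uniqueDiffOn_cylinder (hΩ : IsOpen Ω) (hT : 0 < T) :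
    UniqueDiffOn ℝ (Icc 0 T ×ˢ Ω) :=
  (uniqueDiffOn_Icc hT).prod hΩ.uniqueDiffOn

/-- The time derivative, one-sided at the endpoints, of a function on `[0, T] × Ω`. -/
def timeDeriv (Ω : Set (Vec d)) (T : ℝ) (f : ℝ × Vec d → F) (q : ℝ × Vec d) : F :=
  fderivWithin ℝ f (Icc 0 T ×ˢ Ω) q (1, 0)

theorem SmoothBounded.smoothBounded_timeDeriv (hΩ : IsOpen Ω) (hT : 0 < T) {f : ℝ × Vec d → F}
    (hf : SmoothBounded (Icc 0 T ×ˢ Ω) f) :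
    SmoothBounded (Icc 0 T ×ˢ Ω) (timeDeriv Ω T f) :=
  (hf.smoothBounded_fderivWithin (uniqueDiffOn_cylinder hΩ hT)).clm_comp
    (uniqueDiffOn_cylinder hΩ hT)
    (ContinuousLinearMap.apply ℝ F ((1, 0) : ℝ × Vec d))

theorem SmoothBounded.hasDerivWithinAt_time {f : ℝ × Vec d → F}
    (hf : SmoothBounded (Icc 0 T ×ˢ Ω) f) {x : Vec d} (hx : x ∈ Ω) {t : ℝ} (ht : t ∈ Icc 0 T) :
    HasDerivWithinAt (fun s => f (s, x)) (timeDeriv Ω T f (t, x)) (Icc 0 T) t := by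
  have h1 : HasFDerivWithinAt f (fderivWithin ℝ f (Icc 0 T ×ˢ Ω) (t, x)) (Icc 0 T ×ˢ Ω) (t, x) :=
    (hf.contDiffOn.differentiableOn (by simp) _ ⟨ht, hx⟩).hasFDerivWithinAt
  have h2 : HasDerivWithinAt (fun s : ℝ => (s, x)) ((1, 0) : ℝ × Vec d) (Icc 0 T) t :=
    (hasDerivWithinAt_id t _).prodMk (hasDerivWithinAt_const t _ x)
  exact h1.comp_hasDerivWithinAt t h2 fun s hs => mk_mem_prod hs hx

theorem SmoothBounded.hasFDerivAt_space (hΩ : IsOpen Ω) {f : ℝ × Vec d → F}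
    (hf : SmoothBounded (Icc 0 T ×ˢ Ω) f) {x : Vec d} (hx : x ∈ Ω) {t : ℝ} (ht : t ∈ Icc 0 T) :
    HasFDerivAt (fun y => f (t, y)) ((fderivWithin ℝ f (Icc 0 T ×ˢ Ω) (t, x)).comp
      (ContinuousLinearMap.inr ℝ ℝ (Vec d))) x := by
  have h1 : HasFDerivWithinAt f (fderivWithin ℝ f (Icc 0 T ×ˢ Ω) (t, x)) (Icc 0 T ×ˢ Ω) (t, x) :=
    (hf.contDiffOn.differentiableOn (by simp) _ ⟨ht, hx⟩).hasFDerivWithinAt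
  have h2 : HasFDerivWithinAt (fun y : Vec d => (t, y)) (ContinuousLinearMap.inr ℝ ℝ (Vec d)) Ω x :=
    (hasFDerivAt_prodMk_right t x).hasFDerivWithinAt
  exact (h1.comp x h2 fun y hy => ⟨ht, hy⟩).hasFDerivAt (hΩ.mem_nhds hx)

theorem SmoothBounded.contDiffOn_space {f : ℝ × Vec d → F}
    (hf : SmoothBounded (Icc 0 T ×ˢ Ω) f) {t : ℝ} (ht : t ∈ Icc 0 T) :
    ContDiffOn ℝ ∞ (fun y => f (t, y)) Ω :=
  hf.contDiffOn.comp (contDiff_prodMk_right t).contDiffOn fun _ hy => ⟨ht, hy⟩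

/-- A bound for the time derivative is a Lipschitz constant in time. -/
theorem SmoothBounded.norm_sub_le {f : ℝ × Vec d → F}
    (hf : SmoothBounded (Icc 0 T ×ˢ Ω) f) {M : ℝ}
    (hM : ∀ q ∈ Icc 0 T ×ˢ Ω, ‖timeDeriv Ω T f q‖ ≤ M) {x : Vec d} (hx : x ∈ Ω)
    {s t : ℝ} (hs : s ∈ Icc 0 T) (ht : t ∈ Icc 0 T) : ‖f (s, x) - f (t, x)‖ ≤ M * |s - t| :=
  (convex_Icc (0 : ℝ) T).norm_image_sub_le_of_norm_hasDerivWithin_le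
    (fun _ hr => hf.hasDerivWithinAt_time hx hr) (fun r hr => hM (r, x) ⟨hr, hx⟩) ht hs

theorem SmoothBounded.norm_taylor_le (hΩ : IsOpen Ω) (hT : 0 < T) {f : ℝ × Vec d → F}
    (hf : SmoothBounded (Icc 0 T ×ˢ Ω) f) {M : ℝ}
    (hM : ∀ q ∈ Icc 0 T ×ˢ Ω, ‖timeDeriv Ω T (timeDeriv Ω T f) q‖ ≤ M)
    {x : Vec d} (hx : x ∈ Ω) {s t : ℝ} (hs : s ∈ Icc 0 T) (ht : t ∈ Icc 0 T) :
    ‖f (s, x) - f (t, x) - (s - t) • timeDeriv Ω T f (t, x)‖ ≤ M * |s - t| ^ 2 := by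
  have hM0 : 0 ≤ M := (norm_nonneg _).trans (hM (t, x) ⟨ht, hx⟩)
  have hsub : uIcc t s ⊆ Icc 0 T := uIcc_subset_Icc ht hs
  have := (convex_uIcc t s).norm_image_sub_le_of_norm_hasDerivWithin_le
    (f := fun r => f (r, x) - r • timeDeriv Ω T f (t, x))
    (f' := fun r => timeDeriv Ω T f (r, x) - (1 : ℝ) • timeDeriv Ω T f (t, x))
    (C := M * |s - t|)
    (fun r hr => ((hf.hasDerivWithinAt_time hx (hsub hr)).mono hsub).sub
      ((hasDerivWithinAt_id r _).smul_const _))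
    (fun r hr => by
      rw [one_smul]
      refine ((hf.smoothBounded_timeDeriv hΩ hT).norm_sub_le hM hx (hsub hr) ht).trans ?_
      exact mul_le_mul_of_nonneg_left (abs_sub_left_of_mem_uIcc hr) hM0)
    left_mem_uIcc right_mem_uIcc
  rw [Real.norm_eq_abs] at this
  calc _ = ‖f (s, x) - s • timeDeriv Ω T f (t, x)
        - (f (t, x) - t • timeDeriv Ω T f (t, x))‖ := by congr 1; module
    _ ≤ _ := this.trans_eq (by ring)

open scoped Classical in
/-- The class in `L²(Ω)` of the slice `f(t, ·)`, and `0` should the slice not be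
square-integrable. -/
def lpSlice (Ω : Set (Vec d)) (f : ℝ × Vec d → F) (t : ℝ) : Lp F 2 (volume.restrict Ω) :=
  if h : MemLp (fun x => f (t, x)) 2 (volume.restrict Ω) then h.toLp else 0

variable [SecondCountableTopology F]

theorem SmoothBounded.memLp (hΩ : IsOpen Ω) [IsFiniteMeasure (volume.restrict Ω)]
    {f : ℝ × Vec d → F} (hf : SmoothBounded (Icc 0 T ×ˢ Ω) f) {t : ℝ} (ht : t ∈ Icc 0 T) :
    MemLp (fun x => f (t, x)) 2 (volume.restrict Ω) := by
  obtain ⟨M, -, hM⟩ := hf.exists_norm_le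
  refine MemLp.of_bound
    ((hf.contDiffOn_space ht).continuousOn.aestronglyMeasurable hΩ.measurableSet) M ?_
  filter_upwards [ae_restrict_mem hΩ.measurableSet] with x hx using hM _ ⟨ht, hx⟩

theorem SmoothBounded.coeFn_lpSlice (hΩ : IsOpen Ω) [IsFiniteMeasure (volume.restrict Ω)]
    {f : ℝ × Vec d → F} (hf : SmoothBounded (Icc 0 T ×ˢ Ω) f) {t : ℝ} (ht : t ∈ Icc 0 T) :
    lpSlice Ω f t =ᵐ[volume.restrict Ω] fun x => f (t, x) := by
  rw [lpSlice, dif_pos (hf.memLp hΩ ht)]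
  exact MemLp.coeFn_toLp _

theorem SmoothBounded.hasDerivWithinAt_lpSlice (hΩ : IsOpen Ω) (hT : 0 < T)
    [IsFiniteMeasure (volume.restrict Ω)]
    {f : ℝ × Vec d → F} (hf : SmoothBounded (Icc 0 T ×ˢ Ω) f) {t : ℝ} (ht : t ∈ Icc 0 T) :
    HasDerivWithinAt (lpSlice Ω f) (lpSlice Ω (timeDeriv Ω T f) t) (Icc 0 T) t := by
  obtain ⟨M, hM0, hM⟩ :=
    ((hf.smoothBounded_timeDeriv hΩ hT).smoothBounded_timeDeriv hΩ hT).exists_norm_le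
  rw [hasDerivWithinAt_iff_isLittleO]
  refine Asymptotics.IsBigO.trans_isLittleO (Asymptotics.IsBigO.of_bound
    (measureUnivNNReal (volume.restrict Ω) ^ (2 : ℝ≥0∞).toReal⁻¹ * M) ?_)
    ((Asymptotics.isLittleO_pow_sub_sub t one_lt_two).mono nhdsWithin_le_nhds)
  filter_upwards [self_mem_nhdsWithin] with s hs
  rw [mul_assoc]
  have hbound : ∀ᵐ x ∂volume.restrict Ω,
      ‖(lpSlice Ω f s - lpSlice Ω f t - (s - t) • lpSlice Ω (timeDeriv Ω T f) t :
        Lp F 2 (volume.restrict Ω)) x‖ ≤ M * ‖‖s - t‖ ^ 2‖ := by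
    filter_upwards [ae_restrict_mem hΩ.measurableSet, hf.coeFn_lpSlice hΩ hs,
      hf.coeFn_lpSlice hΩ ht, (hf.smoothBounded_timeDeriv hΩ hT).coeFn_lpSlice hΩ ht,
      Lp.coeFn_sub (lpSlice Ω f s - lpSlice Ω f t)
        ((s - t) • lpSlice Ω (timeDeriv Ω T f) t),
      Lp.coeFn_sub (lpSlice Ω f s) (lpSlice Ω f t),
      Lp.coeFn_smul (s - t) (lpSlice Ω (timeDeriv Ω T f) t)] with x hx h1 h2 h3 h4 h5 h6
    rw [h4, Pi.sub_apply, h5, Pi.sub_apply, h6, Pi.smul_apply, h1, h2, h3, norm_pow,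
      norm_norm, Real.norm_eq_abs]
    exact hf.norm_taylor_le hΩ hT hM hx hs ht
  exact Lp.norm_le_of_ae_bound (mul_nonneg hM0 (norm_nonneg _)) hbound

end TimeSlices

/-! ### Multiplication operators on `L²` -/

section LpMul

variable {X F : Type*} [MeasurableSpace X] {μ : Measure X} [NormedAddCommGroup F]

theorem Lp.norm_le_of_norm_le_indicator {b : Lp F 2 μ} {U : Set X}
    (hU : MeasurableSet U) (hUμ : μ U ≠ ⊤) {N : ℝ} (hN : 0 ≤ N)
    (hb : ∀ᵐ x ∂μ, ‖b x‖ ≤ U.indicator (fun _ => N) x) :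
    ‖b‖ ≤ N * √(μ.real U) := by
  rw [Lp.norm_def]
  have h1 : eLpNorm b 2 μ ≤ ‖N‖ₑ * μ U ^ (1 / (2 : ℝ≥0∞).toReal) := by
    rw [← eLpNorm_indicator_const hU two_ne_zero ENNReal.ofNat_ne_top]
    refine eLpNorm_mono_ae ?_
    filter_upwards [hb] with x hx using hx.trans (Real.le_norm_self _)
  refine (ENNReal.toReal_mono (by finiteness) h1).trans_eq ?_
  rw [ENNReal.toReal_mul, toReal_enorm, Real.norm_of_nonneg hN, ← ENNReal.toReal_rpow,
    Real.sqrt_eq_rpow, measureReal_def]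
  norm_num

variable [InnerProductSpace ℝ F]

/-- Multiplication by an essentially bounded function, as an operator on `L²`. -/
def lpMul (F : Type*) [NormedAddCommGroup F] [InnerProductSpace ℝ F] {a : X → ℝ}
    (ha : MemLp a ∞ μ) : Lp F 2 μ →L[ℝ] Lp F 2 μ :=
  (ContinuousLinearMap.lsmul ℝ ℝ).holderL μ ∞ 2 2 ha.toLp

theorem coeFn_lpMul {a : X → ℝ} (ha : MemLp a ∞ μ) (g : Lp F 2 μ) :
    lpMul F ha g =ᵐ[μ] fun x => a x • g x := by
  have h := (ContinuousLinearMap.lsmul ℝ ℝ (E := F)).coeFn_holder (r := 2) ha.toLp g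
  filter_upwards [h, ha.coeFn_toLp] with x h1 h2
  rw [← h2]
  exact h1

theorem inner_lpMul_eq_integral {a : X → ℝ} (ha : MemLp a ∞ μ) (f g : Lp F 2 μ) :
    inner ℝ (lpMul F ha f) g = ∫ x, a x * inner ℝ (f x) (g x) ∂μ := by
  rw [L2.inner_def]
  refine integral_congr_ae ?_
  filter_upwards [coeFn_lpMul ha f] with x hx
  rw [hx, real_inner_smul_left]

theorem inner_lpMul_symm {a : X → ℝ} (ha : MemLp a ∞ μ) (f g : Lp F 2 μ) :
    inner ℝ (lpMul F ha f) g = inner ℝ f (lpMul F ha g) := by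
  rw [real_inner_comm (lpMul F ha g), inner_lpMul_eq_integral, inner_lpMul_eq_integral]
  simp only [real_inner_comm]

theorem le_inner_lpMul {a : X → ℝ} (ha : MemLp a ∞ μ) {ν : ℝ} (hν : ∀ x, ν ≤ a x)
    (g : Lp F 2 μ) : ν * ‖g‖ ^ 2 ≤ inner ℝ (lpMul F ha g) g := by
  rw [← real_inner_self_eq_norm_sq, L2.inner_def, L2.inner_def, ← integral_const_mul]
  refine integral_mono_ae ((L2.integrable_inner g g).const_mul ν) (L2.integrable_inner _ _) ?_
  filter_upwards [coeFn_lpMul ha g] with x hx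
  rw [hx, real_inner_smul_left]
  exact mul_le_mul_of_nonneg_right (hν x) real_inner_self_nonneg

/-- If `a` equals the constant `κ` off `U`, then `κ - a` acts on bounded functions with a norm
controlled by the measure of `U`. -/
theorem norm_smul_sub_lpMul_le {a : X → ℝ} (ha : MemLp a ∞ μ) {U : Set X}
    (hU : MeasurableSet U) (hUμ : μ U ≠ ⊤) {κ Λ N : ℝ}
    (hκ : ∀ x, |κ - a x| ≤ U.indicator (fun _ => Λ) x) (hΛ : 0 ≤ Λ) (hN : 0 ≤ N)
    {c : Lp F 2 μ} (hc : ∀ᵐ x ∂μ, ‖c x‖ ≤ N) :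
    ‖κ • c - lpMul F ha c‖ ≤ Λ * N * √(μ.real U) := by
  refine Lp.norm_le_of_norm_le_indicator hU hUμ (mul_nonneg hΛ hN) ?_
  filter_upwards [hc, coeFn_lpMul ha c, Lp.coeFn_sub (κ • c) (lpMul F ha c), Lp.coeFn_smul κ c]
    with x h1 h2 h3 h4
  rw [h3, Pi.sub_apply, h4, h2, Pi.smul_apply, ← sub_smul, norm_smul, Real.norm_eq_abs]
  have h5 := hκ x
  by_cases hx : x ∈ U
  · rw [indicator_of_mem hx] at h5 ⊢
    exact mul_le_mul h5 h1 (norm_nonneg _) hΛ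
  · rw [indicator_of_notMem hx] at h5 ⊢
    rw [le_antisymm h5 (abs_nonneg _), zero_mul]

end LpMul

/-! ### Small inhomogeneities -/

section Inhomogeneities

variable {d m : ℕ}

theorem isOpen_inhomogeneity {z : Vec d} {α : ℝ} (hα : 0 < α) {B : Set (Vec d)} (hB : IsOpen B) :
    IsOpen (inhomogeneity z α B) := by
  have : inhomogeneity z α B = (fun y => z + y) '' ((fun y => α • y) '' B) := by
    rw [image_image, inhomogeneity]
  rw [this]
  exact (Homeomorph.addLeft z).isOpenMap _ ((isOpenMap_smul₀ hα.ne') _ hB)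

open scoped Pointwise in
theorem volume_inhomogeneity (z : Vec d) {α : ℝ} (hα : 0 < α) (B : Set (Vec d)) :
    volume (inhomogeneity z α B) = ENNReal.ofReal (α ^ d) * volume B := by
  have : inhomogeneity z α B = (fun y => z + y) '' (α • B) := by
    rw [← image_smul, image_image, inhomogeneity]
  rw [this, image_add_left, measure_preimage_add, Measure.addHaar_smul,
    finrank_euclideanSpace_fin, abs_of_pos (pow_pos hα d)]

theorem disjoint_inhomogeneity {z z' : Vec d} {α c₀ R : ℝ} (hα : 0 < α)
    (hz : c₀ ≤ ‖z - z'‖) {B B' : Set (Vec d)} (hB : B ⊆ Metric.ball 0 R)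
    (hB' : B' ⊆ Metric.ball 0 R) (hR : α * (2 * R) ≤ c₀) :
    Disjoint (inhomogeneity z α B) (inhomogeneity z' α B') := by
  rw [Set.disjoint_left]
  rintro x ⟨y, hy, rfl⟩ ⟨y', hy', h⟩
  have h1 := hB hy
  have h2 := hB' hy'
  rw [mem_ball_zero_iff] at h1 h2
  have h3 : z - z' = α • (y' - y) := by
    have h : z' + α • y' = z + α • y := h
    rw [smul_sub, sub_eq_sub_iff_add_eq_add, ← h, add_comm]
  have h4 : ‖z - z'‖ < α * (2 * R) := by
    rw [h3, norm_smul, Real.norm_of_nonneg hα.le]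
    exact mul_lt_mul_of_pos_left ((norm_sub_le _ _).trans_lt (by linarith)) hα
  linarith

variable {μ₀ : ℝ} {μ : Fin m → ℝ} {z : Fin m → Vec d} {α : ℝ} {B : Fin m → Set (Vec d)}

theorem permeability_of_mem
    (hdisj : Pairwise fun j l =>
      Disjoint (inhomogeneity (z j) α (B j)) (inhomogeneity (z l) α (B l)))
    {j : Fin m} {x : Vec d} (hx : x ∈ inhomogeneity (z j) α (B j)) :
    permeability μ₀ μ z α B x = μ j := by
  rw [permeability, Finset.sum_eq_single j, indicator_of_mem hx]
  · ring
  · intro l _ hl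
    exact indicator_of_notMem (Set.disjoint_left.1 (hdisj hl.symm) hx) _
  · simp

theorem permeability_of_notMem {x : Vec d} (hx : x ∉ ⋃ j, inhomogeneity (z j) α (B j)) :
    permeability μ₀ μ z α B x = μ₀ := by
  rw [mem_iUnion, not_exists] at hx
  rw [permeability, Finset.sum_eq_zero fun j _ => indicator_of_notMem (hx j) _, add_zero]

theorem measurable_permeability (hα : 0 < α) (hB : ∀ j, IsOpen (B j)) :
    Measurable (permeability μ₀ μ z α B) :=
  measurable_const.add (Finset.measurable_fun_sum _ fun j _ =>
    measurable_const.indicator (isOpen_inhomogeneity hα (hB j)).measurableSet)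

theorem permeability_eq_or
    (hdisj : Pairwise fun j l =>
      Disjoint (inhomogeneity (z j) α (B j)) (inhomogeneity (z l) α (B l))) (x : Vec d) :
    permeability μ₀ μ z α B x = μ₀ ∨ ∃ j, permeability μ₀ μ z α B x = μ j := by
  by_cases hx : x ∈ ⋃ j, inhomogeneity (z j) α (B j)
  · obtain ⟨j, hj⟩ := mem_iUnion.1 hx
    exact Or.inr ⟨j, permeability_of_mem hdisj hj⟩
  · exact Or.inl (permeability_of_notMem hx)

theorem inv_permeability_mem_Icc (hμ₀ : 0 < μ₀) (hμ : ∀ j, 0 < μ j)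
    (hdisj : Pairwise fun j l =>
      Disjoint (inhomogeneity (z j) α (B j)) (inhomogeneity (z l) α (B l))) (x : Vec d) :
    1 / permeability μ₀ μ z α B x ∈ Icc (1 / (μ₀ + ∑ j, μ j)) (1 / μ₀ + ∑ j, 1 / μ j) := by
  have hs : 0 ≤ ∑ j, μ j := Finset.sum_nonneg fun j _ => (hμ j).le
  have hs' : 0 ≤ ∑ j, 1 / μ j := Finset.sum_nonneg fun j _ => (one_div_pos.2 (hμ j)).le
  rcases permeability_eq_or (μ₀ := μ₀) (μ := μ) hdisj x with h | ⟨j, h⟩ <;> rw [h]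
  · exact ⟨one_div_le_one_div_of_le hμ₀ (by linarith), by linarith⟩
  · have h1 : μ j ≤ ∑ j, μ j :=
      Finset.single_le_sum (fun l _ => (hμ l).le) (Finset.mem_univ j)
    have h2 : 1 / μ j ≤ ∑ j, 1 / μ j :=
      Finset.single_le_sum (f := fun j => 1 / μ j) (fun l _ => (one_div_pos.2 (hμ l)).le)
        (Finset.mem_univ j)
    have h3 := one_div_pos.2 hμ₀
    exact ⟨one_div_le_one_div_of_le (hμ j) (by linarith), by linarith⟩

/-- The contrast `1/μ₀ - 1/μ_α` is supported in the inhomogeneities. -/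
theorem abs_contrast_le (hμ₀ : 0 < μ₀) (hμ : ∀ j, 0 < μ j)
    (hdisj : Pairwise fun j l =>
      Disjoint (inhomogeneity (z j) α (B j)) (inhomogeneity (z l) α (B l))) (x : Vec d) :
    |1 / μ₀ - 1 / permeability μ₀ μ z α B x|
      ≤ (⋃ j, inhomogeneity (z j) α (B j)).indicator (fun _ => 1 / μ₀ + ∑ j, 1 / μ j) x := by
  by_cases hx : x ∈ ⋃ j, inhomogeneity (z j) α (B j)
  · rw [indicator_of_mem hx]
    have hs : 0 ≤ ∑ j, μ j := Finset.sum_nonneg fun j _ => (hμ j).le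
    have hs' : 0 ≤ ∑ j, 1 / μ j := Finset.sum_nonneg fun j _ => (one_div_pos.2 (hμ j)).le
    have h3 := one_div_pos.2 hμ₀
    have h4 : 0 < 1 / (μ₀ + ∑ j, μ j) := by positivity
    have h5 := inv_permeability_mem_Icc hμ₀ hμ hdisj x
    rw [abs_le]
    exact ⟨by linarith [h5.2], by linarith [h5.1]⟩
  · rw [indicator_of_notMem hx, permeability_of_notMem hx, sub_self, abs_zero]

/-- The `L²` norm of the indicator of the inhomogeneities is of order `α ^ (d / 2)`, hence at most
of order `α`. -/
theorem sqrt_volume_inhomogeneities_le (hd : 2 ≤ d) (hα : 0 < α) (hα1 : α ≤ 1)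
    (hB : ∀ j, volume (B j) ≠ ⊤) (Ω : Set (Vec d)) :
    √((volume.restrict Ω).real (⋃ j, inhomogeneity (z j) α (B j)))
      ≤ α * √(∑ j, volume.real (B j)) := by
  have h1 : (volume.restrict Ω) (⋃ j, inhomogeneity (z j) α (B j))
      ≤ ∑ j, ENNReal.ofReal (α ^ d) * volume (B j) := by
    refine (Measure.restrict_apply_le _ _).trans ((measure_iUnion_fintype_le _ _).trans_eq ?_)
    exact Finset.sum_congr rfl fun j _ => volume_inhomogeneity _ hα _
  have h2 : (volume.restrict Ω).real (⋃ j, inhomogeneity (z j) α (B j))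
      ≤ α ^ 2 * ∑ j, volume.real (B j) := by
    refine (ENNReal.toReal_mono
      (ENNReal.sum_ne_top.2 fun j _ => ENNReal.mul_ne_top ENNReal.ofReal_ne_top (hB j)) h1).trans ?_
    rw [ENNReal.toReal_sum fun j _ => ENNReal.mul_ne_top ENNReal.ofReal_ne_top (hB j),
      Finset.mul_sum]
    refine Finset.sum_le_sum fun j _ => ?_
    rw [ENNReal.toReal_mul, ENNReal.toReal_ofReal (pow_pos hα d).le]
    exact mul_le_mul_of_nonneg_right (pow_le_pow_of_le_one hα.le hα1 hd) ENNReal.toReal_nonneg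
  refine (Real.sqrt_le_sqrt h2).trans_eq ?_
  rw [Real.sqrt_mul (sq_nonneg α), Real.sqrt_sq hα.le]

end Inhomogeneities

/-! ### The unperturbed field -/

section Classical

variable {d : ℕ} {Ω : Set (Vec d)} {T ε₀ μ₀ : ℝ} {φ ψ : Vec d → Vec d} {f : ℝ → Vec d → CurlVec d}
  {E : ℝ → Vec d → Vec d}

/-- The curl of a field on `[0, T] × Ω` with respect to the space variables, read off from the
differential in all variables. -/
def spaceCurl (Ω : Set (Vec d)) (T : ℝ) (u : ℝ × Vec d → Vec d) (q : ℝ × Vec d) : CurlVec d :=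
  curlCLM d ((fderivWithin ℝ u (Icc 0 T ×ˢ Ω) q).comp (ContinuousLinearMap.inr ℝ ℝ (Vec d)))

theorem SmoothBounded.spaceCurl_eq (hΩ : IsOpen Ω) {u : ℝ × Vec d → Vec d}
    (hu : SmoothBounded (Icc 0 T ×ˢ Ω) u) {t : ℝ} (ht : t ∈ Icc 0 T) {x : Vec d} (hx : x ∈ Ω) :
    spaceCurl Ω T u (t, x) = curl (fun y => u (t, y)) x :=
  (hu.hasFDerivAt_space hΩ hx ht).curl_eq.symm

theorem SmoothBounded.smoothBounded_spaceCurl (hΩ : IsOpen Ω) (hT : 0 < T)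
    {u : ℝ × Vec d → Vec d} (hu : SmoothBounded (Icc 0 T ×ˢ Ω) u) :
    SmoothBounded (Icc 0 T ×ˢ Ω) (spaceCurl Ω T u) :=
  (hu.smoothBounded_fderivWithin (uniqueDiffOn_cylinder hΩ hT)).clm_comp
    (uniqueDiffOn_cylinder hΩ hT)
    ((curlCLM d).comp ((ContinuousLinearMap.compL ℝ (Vec d) (ℝ × Vec d) (Vec d)).flip
      (ContinuousLinearMap.inr ℝ ℝ (Vec d))))

theorem SmoothBounded.iteratedDeriv_two {F : Type*} [NormedAddCommGroup F] [NormedSpace ℝ F]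
    (hΩ : IsOpen Ω) (hT : 0 < T) {u : ℝ × Vec d → F}
    (hu : SmoothBounded (Icc 0 T ×ˢ Ω) u) {t : ℝ} (ht : t ∈ Ioo 0 T) {x : Vec d} (hx : x ∈ Ω) :
    iteratedDeriv 2 (fun s => u (s, x)) t = timeDeriv Ω T (timeDeriv Ω T u) (t, x) := by
  have h : ∀ {v : ℝ × Vec d → F}, SmoothBounded (Icc 0 T ×ˢ Ω) v → ∀ s ∈ Ioo 0 T,
      deriv (fun s => v (s, x)) s = timeDeriv Ω T v (s, x) := fun hv s hs =>
    ((hv.hasDerivWithinAt_time hx ⟨hs.1.le, hs.2.le⟩).hasDerivAt (Icc_mem_nhds hs.1 hs.2)).deriv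
  rw [iteratedDeriv_succ, iteratedDeriv_one, ← h (hu.smoothBounded_timeDeriv hΩ hT) t ht]
  refine Filter.EventuallyEq.deriv_eq ?_
  filter_upwards [Ioo_mem_nhds ht.1 ht.2] with s hs using h hu s hs

theorem IsBoundedDomain.isFiniteMeasure {k : WithTop ℕ∞} (hΩ : IsBoundedDomain k Ω) :
    IsFiniteMeasure (volume.restrict Ω) :=
  ⟨by rw [Measure.restrict_apply_univ]; exact hΩ.isBounded.measure_lt_top⟩

theorem IsClassicalMaxwellSolution.smoothBounded {k : WithTop ℕ∞} (hΩ : IsBoundedDomain k Ω)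
    (hT : 0 < T) (hE : IsClassicalMaxwellSolution Ω T ε₀ μ₀ φ ψ f E) :
    SmoothBounded (Icc 0 T ×ˢ Ω) fun q : ℝ × Vec d => E q.1 q.2 :=
  SmoothBounded.of_isCompact (isCompact_Icc.prod hΩ.isBounded.isCompact_closure)
    (prod_mono subset_rfl subset_closure) (uniqueDiffOn_cylinder hΩ.isOpen hT) hE.smooth

/-- Weak form of the unperturbed equation. -/
theorem IsClassicalMaxwellSolution.hasDerivAt_inner {k : WithTop ℕ∞} (hΩ : IsBoundedDomain k Ω)
    (hT : 0 < T) (hE : IsClassicalMaxwellSolution Ω T ε₀ μ₀ φ ψ f E)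
    {v : Vec d → Vec d} (hv : IsTestFunction Ω v)
    {v₁ : Lp (Vec d) 2 (volume.restrict Ω)} (hv₁ : v₁ =ᵐ[volume.restrict Ω] v)
    {v₂ : Lp (CurlVec d) 2 (volume.restrict Ω)} (hv₂ : v₂ =ᵐ[volume.restrict Ω] curl v)
    {t : ℝ} (ht : t ∈ Ioo 0 T) :
    HasDerivAt
      (fun s => ε₀ * inner ℝ (lpSlice Ω (timeDeriv Ω T fun q : ℝ × Vec d => E q.1 q.2) s) v₁)
      (-(1 / μ₀ * inner ℝ (lpSlice Ω (spaceCurl Ω T fun q : ℝ × Vec d => E q.1 q.2) t) v₂)) t := by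
  have := hΩ.isFiniteMeasure
  have htI : t ∈ Icc 0 T := ⟨ht.1.le, ht.2.le⟩
  have hu := hE.smoothBounded hΩ hT
  set u : ℝ × Vec d → Vec d := fun q => E q.1 q.2
  have hut := hu.smoothBounded_timeDeriv hΩ.isOpen hT
  have hutt := hut.smoothBounded_timeDeriv hΩ.isOpen hT
  have huc := hu.smoothBounded_spaceCurl hΩ.isOpen hT
  have h1 := (hut.hasDerivWithinAt_lpSlice hΩ.isOpen hT htI).hasDerivAt
    (Icc_mem_nhds ht.1 ht.2)
  have h2 := ((h1.inner ℝ (hasDerivAt_const t v₁)).const_mul ε₀)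
  refine h2.congr_deriv ?_
  rw [inner_zero_right, zero_add, L2.inner_def, L2.inner_def]
  have e1 : ∫ x in Ω, inner ℝ (lpSlice Ω (timeDeriv Ω T (timeDeriv Ω T u)) t x) (v₁ x)
      = ∫ x in Ω, inner ℝ (timeDeriv Ω T (timeDeriv Ω T u) (t, x)) (v x) := by
    refine integral_congr_ae ?_
    filter_upwards [hutt.coeFn_lpSlice hΩ.isOpen htI, hv₁] with x h3 h4
    rw [h3, h4]
  have e2 : ∫ x in Ω, inner ℝ (lpSlice Ω (spaceCurl Ω T u) t x) (v₂ x)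
      = ∫ x in Ω, inner ℝ (curl (E t) x) (curl v x) := by
    refine integral_congr_ae ?_
    filter_upwards [huc.coeFn_lpSlice hΩ.isOpen htI, hv₂, ae_restrict_mem hΩ.isOpen.measurableSet]
      with x h3 h4 hx
    rw [h3, h4, hu.spaceCurl_eq hΩ.isOpen htI hx]
  have hs : ContDiffOn ℝ 1 (fun y => (1 / μ₀) • curl (E t) y) Ω := by
    refine (((huc.contDiffOn_space htI).of_le (by exact_mod_cast le_top)).const_smul
      (1 / μ₀)).congr fun y hy => ?_
    rw [hu.spaceCurl_eq hΩ.isOpen htI hy]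
  have h5 := integral_inner_vcurl hΩ.isOpen hs hv
  rw [e1, e2, ← integral_const_mul, ← integral_const_mul, ← integral_neg]
  have e3 : ∫ x in Ω, 1 / μ₀ * inner ℝ (curl (E t) x) (curl v x)
      = ∫ x in Ω, inner ℝ ((1 / μ₀) • curl (E t) x) (curl v x) := by
    simp only [real_inner_smul_left]
  rw [integral_neg, e3, ← h5, ← integral_neg]
  refine setIntegral_congr_fun hΩ.isOpen.measurableSet fun x hx => ?_
  have h6 := hE.equation t ht x hx
  rw [hu.iteratedDeriv_two hΩ.isOpen hT ht hx] at h6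
  rw [← real_inner_smul_left, eq_neg_of_add_eq_zero_left h6, inner_neg_left]

end Classical

/-! ### The difference of the perturbed and the unperturbed field -/

section Perturbed

variable {d : ℕ} {Ω : Set (Vec d)}

/-- The pairs `(v, curl v)` in `L² × L²`, for test fields `v`. -/
def testPairs (Ω : Set (Vec d)) :
    Set (Lp (Vec d) 2 (volume.restrict Ω) × Lp (CurlVec d) 2 (volume.restrict Ω)) :=
  {p | ∃ v : Vec d → Vec d, IsTestFunction Ω v ∧ p.1 =ᵐ[volume.restrict Ω] v ∧
    p.2 =ᵐ[volume.restrict Ω] curl v}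

theorem HasZeroTangentialTrace.mem_closure {u : Vec d → Vec d} {g : Vec d → CurlVec d}
    (h : HasZeroTangentialTrace Ω u g) {p : Lp (Vec d) 2 (volume.restrict Ω) ×
      Lp (CurlVec d) 2 (volume.restrict Ω)} (hu : p.1 =ᵐ[volume.restrict Ω] u)
    (hg : p.2 =ᵐ[volume.restrict Ω] g) : p ∈ closure (testPairs Ω) := by
  have key : ∀ {F : Type} [NormedAddCommGroup F] (a : Lp F 2 (volume.restrict Ω))
      {b w : Vec d → F} (hw : MemLp w 2 (volume.restrict Ω)), a =ᵐ[volume.restrict Ω] b →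
      ∀ {δ : ℝ}, eLpNorm (fun x => b x - w x) 2 (volume.restrict Ω) < ENNReal.ofReal δ →
      dist a hw.toLp < δ := by
    intro F _ a b w hw hab δ hδ
    rw [Lp.dist_def, ← ENNReal.lt_ofReal_iff_toReal_lt]
    · refine (eLpNorm_congr_ae ?_).trans_lt hδ
      filter_upwards [hab, hw.coeFn_toLp] with x h1 h2
      rw [Pi.sub_apply, h1, h2]
    · exact ((Lp.memLp a).sub (Lp.memLp _)).eLpNorm_ne_top
  rw [Metric.mem_closure_iff]
  intro δ hδ
  obtain ⟨v, hv, h1, h2⟩ := h δ hδ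
  refine ⟨((hv.memLp 2).toLp, (hv.curl.memLp 2).toLp),
    ⟨v, hv, (hv.memLp 2).coeFn_toLp, (hv.curl.memLp 2).coeFn_toLp⟩, ?_⟩
  rw [Prod.dist_eq]
  exact max_lt (key p.1 (hv.memLp 2) hu h1) (key p.2 (hv.curl.memLp 2) hg h2)

/-- The difference of the two fields solves the perturbed equation with zero initial and boundary
data and the source `curl ((1/μ₀ - 1/μ) curl E)`, so the energy estimate bounds its curl by the
`L²` norm of the contrast. -/
theorem IsWeakMaxwellSolution.exists_curl_sub_norm_le {k : WithTop ℕ∞} {T ε₀ μ₀ : ℝ}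
    {φ ψ : Vec d → Vec d} {f : ℝ → Vec d → CurlVec d} {E : ℝ → Vec d → Vec d}
    {μ : Vec d → ℝ} {Eα : ℝ → Lp (Vec d) 2 (volume.restrict Ω)} {ν Λ M : ℝ} {U : Set (Vec d)}
    (hΩ : IsBoundedDomain k Ω) (hT : 0 < T) (hε₀ : 0 ≤ ε₀)
    (hE : IsClassicalMaxwellSolution Ω T ε₀ μ₀ φ ψ f E)
    (hα : IsWeakMaxwellSolution Ω T ε₀ μ φ ψ f Eα)
    (hμm : Measurable μ) (hν : 0 < ν) (hμ : ∀ x, 1 / μ x ∈ Icc ν Λ) (hU : MeasurableSet U)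
    (hcontrast : ∀ x, |1 / μ₀ - 1 / μ x| ≤ U.indicator (fun _ => Λ) x) (hM0 : 0 ≤ M)
    (hM : ∀ q ∈ Icc 0 T ×ˢ Ω, ‖spaceCurl Ω T (fun q : ℝ × Vec d => E q.1 q.2) q‖ ≤ M)
    (hM' : ∀ q ∈ Icc 0 T ×ˢ Ω,
      ‖timeDeriv Ω T (spaceCurl Ω T fun q : ℝ × Vec d => E q.1 q.2) q‖ ≤ M) :
    ∃ K : ℝ → Lp (CurlVec d) 2 (volume.restrict Ω), ContinuousOn K (Icc 0 T) ∧
      (∀ t ∈ Icc 0 T, IsWeakCurl Ω (fun x => Eα t x - E t x) (K t)) ∧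
      ∀ t ∈ Icc 0 T,
        ‖K t‖ ≤ 2 * (1 + T) / ν * (Λ * M * √((volume.restrict Ω).real U)) := by
  have := hΩ.isFiniteMeasure
  have hΩo := hΩ.isOpen
  have h0 : (0 : ℝ) ∈ Icc 0 T := ⟨le_rfl, hT.le⟩
  have hu := hE.smoothBounded hΩ hT
  set u : ℝ × Vec d → Vec d := fun q => E q.1 q.2
  have hut := hu.smoothBounded_timeDeriv hΩo hT
  have huc := hu.smoothBounded_spaceCurl hΩo hT
  obtain ⟨E', G, hE'c, hEα, hGc, hcurl, hweak, -, hinit, hinit', htrace⟩ := hα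
  have hΛ : 0 ≤ Λ := hν.le.trans ((hμ 0).1.trans (hμ 0).2)
  have ha : MemLp (fun x => 1 / μ x) ⊤ (volume.restrict Ω) :=
    memLp_top_of_bound (measurable_const.div hμm).aestronglyMeasurable Λ
      (Filter.Eventually.of_forall fun x => by
        rw [Real.norm_of_nonneg (hν.le.trans (hμ x).1)]; exact (hμ x).2)
  have hcc : ContinuousOn (lpSlice Ω (spaceCurl Ω T u)) (Icc 0 T) := fun t ht =>
    (huc.hasDerivWithinAt_lpSlice hΩo hT ht).continuousWithinAt
  have hKc : ContinuousOn (fun t => G t - lpSlice Ω (spaceCurl Ω T u) t) (Icc 0 T) := hGc.sub hcc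
  -- the curl of the difference
  have hKcurl : ∀ t ∈ Icc 0 T, IsWeakCurl Ω (fun x => Eα t x - E t x)
      (G t - lpSlice Ω (spaceCurl Ω T u) t : Lp (CurlVec d) 2 (volume.restrict Ω)) := by
    intro t ht
    have hc : IsWeakCurl Ω (E t) (lpSlice Ω (spaceCurl Ω T u) t) := by
      refine (isWeakCurl_curl hΩo ((hu.contDiffOn_space ht).of_le
        (by exact_mod_cast le_top))).congr_ae (Filter.EventuallyEq.refl _ _) ?_
      filter_upwards [huc.coeFn_lpSlice hΩo ht, ae_restrict_mem hΩo.measurableSet] with x h1 hx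
      rw [h1, hu.spaceCurl_eq hΩo ht hx]
    exact ((hcurl t ht).sub hc (Lp.memLp _) (hu.memLp hΩo ht) (Lp.memLp _)
      (Lp.memLp _)).congr_ae (Filter.EventuallyEq.refl _ _) (Lp.coeFn_sub _ _).symm
  refine ⟨fun t => G t - lpSlice Ω (spaceCurl Ω T u) t, hKc, hKcurl, ?_⟩
  -- the contrast term
  have hnorm : ∀ (c : Lp (CurlVec d) 2 (volume.restrict Ω)) {N : ℝ}, 0 ≤ N →
      (∀ᵐ x ∂volume.restrict Ω, ‖c x‖ ≤ N) →
      ‖(1 / μ₀) • c - lpMul (CurlVec d) ha c‖ ≤ Λ * N * √((volume.restrict Ω).real U) :=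
    fun c N hN hc => norm_smul_sub_lpMul_le ha hU (measure_ne_top _ _) hcontrast hΛ hN hc
  intro t ht
  refine norm_le_of_weak_wave_equation (ε := ε₀) hT hε₀ hν (lpMul (CurlVec d) ha)
    (inner_lpMul_symm ha) (le_inner_lpMul ha fun x => (hμ x).1) (testPairs Ω)
    (w := fun t => Eα t - lpSlice Ω u t) (w' := fun t => E' t - lpSlice Ω (timeDeriv Ω T u) t)
    (g := fun t => G t - lpSlice Ω (spaceCurl Ω T u) t)
    (F := fun t => (1 / μ₀) • lpSlice Ω (spaceCurl Ω T u) t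
      - lpMul (CurlVec d) ha (lpSlice Ω (spaceCurl Ω T u) t))
    (fun t ht => (hEα t ht).sub (hu.hasDerivWithinAt_lpSlice hΩo hT ht))
    (hE'c.sub fun t ht => (hut.hasDerivWithinAt_lpSlice hΩo hT ht).continuousWithinAt)
    hKc ?_ ?_ ?_ ?_ ?_ ?_ ht
  · intro t ht
    refine hnorm _ hM0 ?_
    filter_upwards [huc.coeFn_lpSlice hΩo ht, ae_restrict_mem hΩo.measurableSet] with x h1 hx
    rw [h1]
    exact hM _ ⟨ht, hx⟩
  · intro s hs t ht
    have e : (1 / μ₀) • lpSlice Ω (spaceCurl Ω T u) s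
        - lpMul (CurlVec d) ha (lpSlice Ω (spaceCurl Ω T u) s)
        - ((1 / μ₀) • lpSlice Ω (spaceCurl Ω T u) t
          - lpMul (CurlVec d) ha (lpSlice Ω (spaceCurl Ω T u) t))
        = (1 / μ₀) • (lpSlice Ω (spaceCurl Ω T u) s - lpSlice Ω (spaceCurl Ω T u) t)
          - lpMul (CurlVec d) ha
            (lpSlice Ω (spaceCurl Ω T u) s - lpSlice Ω (spaceCurl Ω T u) t) := by
      rw [map_sub, smul_sub]
      abel
    rw [e]
    refine (hnorm _ (mul_nonneg hM0 (abs_nonneg (s - t))) ?_).trans_eq (by ring)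
    filter_upwards [huc.coeFn_lpSlice hΩo hs, huc.coeFn_lpSlice hΩo ht,
      Lp.coeFn_sub (lpSlice Ω (spaceCurl Ω T u) s) (lpSlice Ω (spaceCurl Ω T u) t),
      ae_restrict_mem hΩo.measurableSet] with x h1 h2 h3 hx
    rw [h3, Pi.sub_apply, h1, h2]
    exact huc.norm_sub_le hM' hx hs ht
  · intro t ht
    have htI : t ∈ Icc 0 T := ⟨ht.1.le, ht.2.le⟩
    refine closure_mono Submodule.subset_span (HasZeroTangentialTrace.mem_closure
      ((htrace t ht).2 (E t) ?_ (hE.boundary t ht)) ?_ ?_)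
    · exact (hE.smooth.comp (contDiff_prodMk_right t).contDiffOn
        fun x hx => mk_mem_prod htI hx).of_le (by exact_mod_cast le_top)
    · filter_upwards [Lp.coeFn_sub (Eα t) (lpSlice Ω u t), hu.coeFn_lpSlice hΩo htI] with x h1 h2
      rw [h1, Pi.sub_apply, h2]
    · filter_upwards [Lp.coeFn_sub (G t) (lpSlice Ω (spaceCurl Ω T u) t),
        huc.coeFn_lpSlice hΩo htI, ae_restrict_mem hΩo.measurableSet] with x h1 h2 hx
      rw [h1, Pi.sub_apply, h2, hu.spaceCurl_eq hΩo htI hx]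
  · rintro ⟨v₁, v₂⟩ ⟨v, hv, hv₁, hv₂⟩ t ht
    have d1 := hE.hasDerivAt_inner hΩ hT hv hv₁ hv₂ ht
    have d2 : HasDerivAt (fun s => ε₀ * inner ℝ (E' s) v₁)
        (-inner ℝ (lpMul (CurlVec d) ha (G t)) v₂) t := by
      have e1 : ∀ s, ε₀ * inner ℝ (E' s) v₁ = ∫ x in Ω, ε₀ * inner ℝ (E' s x) (v x) := by
        intro s
        rw [L2.inner_def, ← integral_const_mul]
        refine integral_congr_ae ?_
        filter_upwards [hv₁] with x hx
        rw [hx]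
      have e2 : inner ℝ (lpMul (CurlVec d) ha (G t)) v₂
          = ∫ x in Ω, 1 / μ x * inner ℝ (G t x) (curl v x) := by
        rw [inner_lpMul_eq_integral]
        refine integral_congr_ae ?_
        filter_upwards [hv₂] with x hx
        rw [hx]
      simp only [e1, e2]
      exact hweak v hv t ht
    have d3 := d2.sub d1
    have e : (fun s => ε₀ * inner ℝ (E' s - lpSlice Ω (timeDeriv Ω T u) s) v₁)
        = (fun s => ε₀ * inner ℝ (E' s) v₁)
          - fun s => ε₀ * inner ℝ (lpSlice Ω (timeDeriv Ω T u) s) v₁ := by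
      funext s
      rw [Pi.sub_apply, inner_sub_left, mul_sub]
    simp only [e]
    refine d3.congr_deriv ?_
    simp only [map_sub, inner_sub_left, real_inner_smul_left]
    ring
  · rw [sub_eq_zero]
    refine Lp.ext ?_
    filter_upwards [hinit', hut.coeFn_lpSlice hΩo h0, ae_restrict_mem hΩo.measurableSet]
      with x h1 h2 hx
    rw [h1, h2, ← hE.initial_deriv x hx]
    exact ((hu.hasDerivWithinAt_time hx h0).derivWithin (uniqueDiffOn_Icc hT 0 h0))
  · refine (Lp.eq_zero_iff_ae_eq_zero).2 ((hKcurl 0 h0).ae_eq_zero hΩo ?_ (Lp.memLp _))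
    filter_upwards [hinit, ae_restrict_mem hΩo.measurableSet] with x h1 hx
    rw [h1, hE.initial x hx, sub_self, Pi.zero_apply]

end Perturbed

/-! ### The estimate for small inhomogeneities -/

end

theorem mainTheorem5 (d : ℕ) (hd : d = 2 ∨ d = 3)
    (Ω : Set (Vec d)) (hΩ : IsBoundedDomain 2 Ω)
    (T ε₀ μ₀ : ℝ) (hT : 0 < T) (hε₀ : 0 < ε₀) (hμ₀ : 0 < μ₀)
    (m : ℕ) (μ : Fin m → ℝ) (hμ : ∀ j, 0 < μ j)
    (B : Fin m → Set (Vec d)) (hB : ∀ j, IsBoundedDomain ∞ (B j)) (hB0 : ∀ j, 0 ∈ B j)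
    (c₀ : ℝ) (hc₀ : 0 < c₀)
    (φ ψ : Vec d → Vec d) (hφ : ContDiffOn ℝ ∞ φ (closure Ω))
    (hψ : ContDiffOn ℝ ∞ ψ (closure Ω))
    (f : ℝ → Vec d → CurlVec d)
    (E : ℝ → Vec d → Vec d) (hE : IsClassicalMaxwellSolution Ω T ε₀ μ₀ φ ψ f E) :
    ∃ α₀ : ℝ, 0 < α₀ ∧ ∃ C : ℝ, 0 < C ∧
      ∀ z : Fin m → Vec d,
        (∀ j, z j ∈ Ω) →
        (∀ j l, j ≠ l → c₀ ≤ ‖z j - z l‖) →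
        (∀ j, c₀ ≤ Metric.infDist (z j) (frontier Ω)) →
        ∀ α : ℝ, 0 < α → α < α₀ →
        ∀ Eα : ℝ → Lp (Vec d) 2 (volume.restrict Ω),
          IsWeakMaxwellSolution Ω T ε₀ (permeability μ₀ μ z α B) φ ψ f Eα →
          ∃ K : ℝ → Lp (CurlVec d) 2 (volume.restrict Ω),
            (∀ t ∈ Icc 0 T, IsWeakCurl Ω (fun x => Eα t x - E t x) (K t)) ∧
            MemLp K ∞ (volume.restrict (Ioo 0 T)) ∧
            eLpNorm K ∞ (volume.restrict (Ioo 0 T)) ≤ ENNReal.ofReal (C * α) := by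
  have := hΩ.isFiniteMeasure
  have hu := hE.smoothBounded hΩ hT
  have huc := hu.smoothBounded_spaceCurl hΩ.isOpen hT
  obtain ⟨M₁, hM₁0, hM₁⟩ := huc.exists_norm_le
  obtain ⟨M₂, -, hM₂⟩ := (huc.smoothBounded_timeDeriv hΩ.isOpen hT).exists_norm_le
  obtain ⟨R, hR0, hR⟩ := (Bornology.isBounded_iUnion.2 fun j => (hB j).isBounded).subset_ball_lt
    0 (0 : Vec d)
  have hBR : ∀ j, B j ⊆ Metric.ball 0 R := fun j => (subset_iUnion B j).trans hR
  have hΛ : 0 < 1 / μ₀ + ∑ j, 1 / μ j :=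
    add_pos_of_pos_of_nonneg (one_div_pos.2 hμ₀)
      (Finset.sum_nonneg fun j _ => (one_div_pos.2 (hμ j)).le)
  have hν : 0 < 1 / (μ₀ + ∑ j, μ j) :=
    one_div_pos.2 (add_pos_of_pos_of_nonneg hμ₀ (Finset.sum_nonneg fun j _ => (hμ j).le))
  set Λ := 1 / μ₀ + ∑ j, 1 / μ j
  set ν := 1 / (μ₀ + ∑ j, μ j)
  set M := max M₁ M₂
  have hM0 : 0 ≤ M := le_max_of_le_left hM₁0
  have hC : 0 ≤ 2 * (1 + T) / ν * (Λ * M * √(∑ j, volume.real (B j))) := by positivity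
  -- the bound `c₀ / (2 R)` on `α` makes the inhomogeneities disjoint
  refine ⟨min 1 (c₀ / (2 * R)), by positivity,
    2 * (1 + T) / ν * (Λ * M * √(∑ j, volume.real (B j))) + 1, by positivity, ?_⟩
  intro z _ hz _ α hα hα₀ Eα hEα
  have hα1 : α ≤ 1 := hα₀.le.trans (min_le_left _ _)
  have hαR : α * (2 * R) ≤ c₀ :=
    (le_div_iff₀ (by positivity)).1 (hα₀.le.trans (min_le_right _ _))
  have hdisj : Pairwise fun j l =>
      Disjoint (inhomogeneity (z j) α (B j)) (inhomogeneity (z l) α (B l)) := fun j l hjl =>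
    disjoint_inhomogeneity hα (hz j l hjl) (hBR j) (hBR l) hαR
  obtain ⟨K, hKc, hKcurl, hK⟩ := hEα.exists_curl_sub_norm_le hΩ hT hε₀.le hE
    (measurable_permeability hα fun j => (hB j).isOpen) hν
    (inv_permeability_mem_Icc hμ₀ hμ hdisj)
    (MeasurableSet.iUnion fun j => (isOpen_inhomogeneity hα (hB j).isOpen).measurableSet)
    (abs_contrast_le hμ₀ hμ hdisj) hM0 (fun q hq => (hM₁ q hq).trans (le_max_left _ _))
    (fun q hq => (hM₂ q hq).trans (le_max_right _ _))
  have hvol := sqrt_volume_inhomogeneities_le (z := z) (B := B)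
    (by rcases hd with rfl | rfl <;> norm_num : 2 ≤ d) hα hα1
    (fun j => (hB j).isBounded.measure_lt_top.ne) Ω
  have hbound : ∀ᵐ t ∂(volume.restrict (Ioo 0 T)),
      ‖K t‖ ≤ (2 * (1 + T) / ν * (Λ * M * √(∑ j, volume.real (B j))) + 1) * α := by
    filter_upwards [ae_restrict_mem measurableSet_Ioo] with t ht
    calc ‖K t‖ ≤ _ := hK t ⟨ht.1.le, ht.2.le⟩
      _ ≤ 2 * (1 + T) / ν * (Λ * M * (α * √(∑ j, volume.real (B j)))) := by gcongr
      _ = 2 * (1 + T) / ν * (Λ * M * √(∑ j, volume.real (B j))) * α := by ring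
      _ ≤ _ := by nlinarith
  refine ⟨K, hKcurl, memLp_top_of_bound ((hKc.mono Ioo_subset_Icc_self).aestronglyMeasurable
    measurableSet_Ioo) _ hbound, ?_⟩
  rw [eLpNorm_exponent_top]
  exact eLpNormEssSup_le_of_ae_bound hbound
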